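/- \textbf{Setting.} Let $T$ be a complete many-sorted first-order theory which is stable (no formula has the order property) and eliminates imaginaries: every $\emptyset$-definable equivalence relation on a finite product of sorts is of the form $f(x)=f(y)$ for an $\emptyset$-definable function $f$ into a finite product of sorts. (For instance $T=(T_0^{\mathrm{eq}})^m$, the Morleyisation of $T_0^{\mathrm{eq}}$, for a complete stable theory $T_0$.) Let $\mathfrak C\models T$ be a monster model: $\mathfrak C$ is $\kappa$-saturated and strongly $\kappa$-homogeneous for some cardinal $\kappa>|\mathcal L|+\aleph_0$, where $\mathcal L$ is the language of $T$. Subsets of $\mathfrak C$ of cardinality $<\kappa$ are called small. \textbf{Definitions.} For $A\subseteq B\subseteq\mathfrak C$ let $\operatorname{Aut}(B/A)$ be the group of permutations of $B$ which preserve sorts, are elementary in $\mathfrak C$, and fix $A$ pointwise (if $T$ has quantifier elimination and $B$ is a substructure, these are the automorphisms of $B$ over $A$). Put $\mathcal G(B/A)=\operatorname{Aut}(\operatorname{dcl}(B)/\operatorname{dcl}(A))$ and $\mathcal G(A)=\operatorname{Aut}(\operatorname{acl}(A)/\operatorname{dcl}(A))$, with the topology of pointwise convergence, $\operatorname{acl}(A)$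 being discrete. $\mathcal N(\mathcal G(A))$ is the set of open normal subgroups of $\mathcal G(A)$, and $\operatorname{acl}(A)^N$ is the set of elements of $\operatorname{acl}(A)$ fixed by $N\le\mathcal G(A)$. An extension $K\subseteq L$ is Galois if $L=\operatorname{dcl}(L)\subseteq\operatorname{acl}(K)$ and $L$ is stable under $\operatorname{Aut}(\mathfrak C/K)$; then $e(L/K)$ denotes the set of its primitive elements, i.e. of those elements $a\in\mathfrak C$ with $L=\operatorname{dcl}(K,a)$. For a finite tuple $J=(S_1,\dots,S_n)$ of sorts put $S_J(L)=S_1(L)\times\dots\times S_n(L)$, and for definably closed $L\supseteq K$ let $\operatorname{Aut}_J(L/K)$ be the image of $\mathcal G(L/K)$ in the permutation group of $S_J(L)$. For $N\in\mathcal N(\mathcal G(K))$ let $\mathcal F(N)$ be the set of all $J$ with $|\operatorname{Aut}_J(\operatorname{acl}(K)^N/K)|=|\mathcal G(\operatorname{acl}(K)^N/K)|$. A homomorphism $\pi:\mathcal G(F)\to\mathcal G(E)$ is sorted if it is a continuous epimorphism and $\mathcal F(N)\subseteq\mathcal F(\pi^{-1}[N])$ for every $N\in\mathcal N(\mathcal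 G(E))$. \textbf{Proposition.} Let $E\subseteq F$ be small subsets (in particular, small substructures) of $\mathfrak C$ such that the extension $E\subseteq F$ is regular, i.e. $\operatorname{dcl}(F)\cap\operatorname{acl}(E)=\operatorname{dcl}(E)$, and let $\pi:\mathcal G(F)\to\mathcal G(E)$ be the restriction map $\sigma\mapsto\sigma|_{\operatorname{acl}(E)}$. For every $N\in\mathcal N(\mathcal G(E))$, if $a\in e(\operatorname{acl}(E)^N/E)$, then $a\in e(\operatorname{acl}(F)^{\pi^{-1}[N]}/F)$. Moreover, $\pi$ is sorted (in particular, it is a continuous epimorphism). -/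

import Mathlib

universe u

/-! Many-sorted first-order logic. -/

/-- A many-sorted first-order language. A function symbol has a finite tuple of argument sorts
and a value sort; a relation symbol has a finite tuple of argument sorts. -/
structure MSLanguage where
  /-- the sorts -/
  Sorts : Type u
  /-- the function symbols with argument sorts `σ` and value sort `s` -/
  Func : (n : ℕ) → (σ : Fin n → Sorts) → (s : Sorts) → Type u
  /-- the relation symbols with argument sorts `σ` -/
  Rel : (n : ℕ) → (σ : Fin n → Sorts) → Type u

namespace MSLanguage

variable (L : MSLanguage.{u})

/-- Terms of sort `s` in the variables `x₀, …, xₙ₋₁`, where `xᵢ` has sort `σ i`. -/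
inductive Term {n : ℕ} (σ : Fin n → L.Sorts) : L.Sorts → Type u
  | var (i : Fin n) : Term σ (σ i)
  | app {m : ℕ} {τ : Fin m → L.Sorts} {s : L.Sorts} (f : L.Func m τ s)
      (t : ∀ i, Term σ (τ i)) : Term σ s

/-- First-order formulas with free variables among `x₀, …, xₙ₋₁`, where `xᵢ` has sort `σ i`.
In `all s φ` the quantified variable has sort `s` and is variable `0` of `φ`. -/
inductive Formula : (n : ℕ) → (Fin n → L.Sorts) → Type u
  | falsum {n : ℕ} {σ : Fin n → L.Sorts} : Formula n σ
  | equal {n : ℕ} {σ : Fin n → L.Sorts} {s : L.Sorts} (t₁ t₂ : L.Term σ s) : Formula n σ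
  | rel {n : ℕ} {σ : Fin n → L.Sorts} {m : ℕ} {τ : Fin m → L.Sorts} (R : L.Rel m τ)
      (t : ∀ i, L.Term σ (τ i)) : Formula n σ
  | imp {n : ℕ} {σ : Fin n → L.Sorts} (φ ψ : Formula n σ) : Formula n σ
  | all {n : ℕ} {σ : Fin n → L.Sorts} (s : L.Sorts)
      (φ : Formula (n + 1) (Fin.cons s σ)) : Formula n σ

/-- Sentences: formulas without free variables. -/
abbrev Sentence : Type u := L.Formula 0 (fun i => i.elim0)

/-- Theories: sets of sentences. -/
abbrev Theory : Type u := Set L.Sentence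

/-- A many-sorted structure. -/
structure Struct where
  /-- the set of elements of a given sort -/
  Carrier : L.Sorts → Type u
  /-- interpretation of function symbols -/
  func : ∀ {n : ℕ} {σ : Fin n → L.Sorts} {s : L.Sorts},
    L.Func n σ s → (∀ i, Carrier (σ i)) → Carrier s
  /-- interpretation of relation symbols -/
  rel : ∀ {n : ℕ} {σ : Fin n → L.Sorts}, L.Rel n σ → (∀ i, Carrier (σ i)) → Prop

variable {L} in
/-- The tuple `a, v₀, …, vₙ₋₁`, where `a` has sort `s` and `vᵢ` has sort `σ i`, in a family `X`
of sets indexed by the sorts. -/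
def tupleCons {X : L.Sorts → Type u} {n : ℕ} {σ : Fin n → L.Sorts} {s : L.Sorts} (a : X s)
    (v : ∀ i, X (σ i)) : ∀ i, X ((Fin.cons s σ : Fin (n + 1) → L.Sorts) i) :=
  Fin.cons (α := fun i => X ((Fin.cons s σ : Fin (n + 1) → L.Sorts) i)) a v

/-- The cardinality of a language (number of its sorts and symbols). -/
noncomputable def card : Cardinal.{u} :=
  Cardinal.mk L.Sorts
    + Cardinal.mk (Σ (n : ℕ) (σ : Fin n → L.Sorts) (s : L.Sorts), L.Func n σ s)
    + Cardinal.mk (Σ (n : ℕ) (σ : Fin n → L.Sorts), L.Rel n σ)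

variable {L}

/-- Value of a term. -/
def Term.val (M : L.Struct) {n : ℕ} {σ : Fin n → L.Sorts} (v : ∀ i, M.Carrier (σ i)) :
    ∀ {s : L.Sorts}, L.Term σ s → M.Carrier s
  | _, .var i => v i
  | _, .app f t => M.func f (fun i => (t i).val M v)

/-- Tarski's definition of satisfaction. -/
def Formula.Realize (M : L.Struct) :
    ∀ {n : ℕ} {σ : Fin n → L.Sorts}, L.Formula n σ → (∀ i, M.Carrier (σ i)) → Prop
  | _, _, .falsum, _ => False
  | _, _, .equal t₁ t₂, v => t₁.val M v = t₂.val M v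
  | _, _, .rel R t, v => M.rel R (fun i => (t i).val M v)
  | _, _, .imp φ ψ, v => φ.Realize M v → ψ.Realize M v
  | _, _, .all s φ, v => ∀ a : M.Carrier s, φ.Realize M (tupleCons (X := M.Carrier) a v)

namespace Struct

variable (M : L.Struct)

/-- The complete theory of `M`. -/
def theory : L.Theory := {φ | φ.Realize M (fun i => i.elim0)}

/-- `M` is a model of `T`. -/
def IsModel (T : L.Theory) : Prop := ∀ φ ∈ T, φ.Realize M (fun i => i.elim0)

/-- The formula `φ`, with its free variables divided into the tuple `x` of the variables `i` with
`p i = true` and the tuple `y` of the other ones, has a ladder of length `k` in `M`: tuples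
`a₀, b₀, …, aₖ₋₁, bₖ₋₁` such that `φ(aᵢ, bⱼ)` holds exactly if `i < j`. Here `c i` is the tuple
whose `x`-part is `aᵢ` and whose `y`-part is `bᵢ`. -/
def HasLadder {n : ℕ} {σ : Fin n → L.Sorts} (φ : L.Formula n σ) (p : Fin n → Bool) (k : ℕ) :
    Prop :=
  ∃ c : Fin k → ∀ i, M.Carrier (σ i), ∀ i j : Fin k,
    φ.Realize M (fun v => if p v = true then c i v else c j v) ↔ i < j

/-- A relation between elements of sorts `σ i`, `i : ι`, is definable without parameters. -/
def Definable₀ {ι : Type} (σ : ι → L.Sorts) (R : Set (∀ i, M.Carrier (σ i))) : Prop :=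
  ∃ (n : ℕ) (e : Fin n → ι) (φ : L.Formula n (fun k => σ (e k))),
    ∀ v, v ∈ R ↔ φ.Realize M (fun k => v (e k))

/-- Every `∅`-definable equivalence relation `θ` on a finite product of sorts is of the form
`f a = f b` for an `∅`-definable function `f` into a finite product of sorts. -/
def HasEI : Prop :=
  ∀ (n : ℕ) (σ : Fin n → L.Sorts) (θ : Setoid (∀ i, M.Carrier (σ i))),
    M.Definable₀ (Sum.elim σ σ) {v | θ (fun i => v (Sum.inl i)) (fun i => v (Sum.inr i))} →
    ∃ (m : ℕ) (τ : Fin m → L.Sorts) (f : (∀ i, M.Carrier (σ i)) → ∀ j, M.Carrier (τ j)),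
      M.Definable₀ (Sum.elim σ τ) {v | f (fun i => v (Sum.inl i)) = fun j => v (Sum.inr j)} ∧
      ∀ a b, f a = f b ↔ θ a b

end Struct

/-- `T` is stable: no formula has the order property, that is, for every formula with divided
variables there is a bound on the lengths of its ladders in models of `T`. -/
def Theory.IsStable (T : L.Theory) : Prop :=
  ∀ (n : ℕ) (σ : Fin n → L.Sorts) (φ : L.Formula n σ) (p : Fin n → Bool),
    ∃ k : ℕ, ∀ M : L.Struct, M.IsModel T → ¬ M.HasLadder φ p k

/-- `T` eliminates imaginaries. -/
def Theory.EliminatesImaginaries (T : L.Theory) : Prop :=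
  ∀ M : L.Struct, M.IsModel T → M.HasEI

namespace Struct

variable (M : L.Struct)

/-! Subsets, definable and algebraic closure. -/

/-- A subset of a many-sorted structure, given sort by sort (ordered by inclusion). -/
abbrev SSet : Type u := ∀ s : L.Sorts, Set (M.Carrier s)

variable {M}

/-- The cardinality of a subset of `M`. -/
noncomputable def SSet.card (A : M.SSet) : Cardinal.{u} := Cardinal.mk (Σ s, A s)

/-- The set `X` of elements of sort `s` is definable in `M` with parameters from `A`:
`X = {x | M ⊨ φ(x, e)}` for a formula `φ` and a finite tuple `e` from `A`. -/
def DefinableOver (A : M.SSet) {s : L.Sorts} (X : Set (M.Carrier s)) : Prop :=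
  ∃ (n : ℕ) (τ : Fin n → L.Sorts) (φ : L.Formula (n + 1) (Fin.cons s τ)) (e : ∀ i, A (τ i)),
    X = {x | φ.Realize M (tupleCons (X := M.Carrier) x (fun i => (e i : M.Carrier (τ i))))}

/-- Definable closure. -/
def dcl (A : M.SSet) : M.SSet := fun s => {a | DefinableOver A ({a} : Set (M.Carrier s))}

/-- Algebraic closure. -/
def acl (A : M.SSet) : M.SSet :=
  fun s => {a | ∃ X : Set (M.Carrier s), DefinableOver A X ∧ X.Finite ∧ a ∈ X}

/-- `A` together with the element `a` of sort `s`. -/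
def adjoin (A : M.SSet) {s : L.Sorts} (a : M.Carrier s) : M.SSet :=
  fun t => A t ∪ {y | (⟨t, y⟩ : Σ r, M.Carrier r) = ⟨s, a⟩}

/-- A sort-preserving map defined on `A` is elementary: it preserves all formulas of `M`. -/
def IsElementary {A : M.SSet} (f : ∀ s, A s → M.Carrier s) : Prop :=
  ∀ (n : ℕ) (σ : Fin n → L.Sorts) (φ : L.Formula n σ) (a : ∀ i, A (σ i)),
    φ.Realize M (fun i => (a i : M.Carrier (σ i))) ↔ φ.Realize M (fun i => f (σ i) (a i))

variable (M) in
/-- Automorphisms of the structure `M`. -/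
structure IsAut (g : ∀ s, Equiv.Perm (M.Carrier s)) : Prop where
  func : ∀ {n : ℕ} {σ : Fin n → L.Sorts} {s : L.Sorts} (f : L.Func n σ s)
    (a : ∀ i, M.Carrier (σ i)), g s (M.func f a) = M.func f (fun i => g (σ i) (a i))
  rel : ∀ {n : ℕ} {σ : Fin n → L.Sorts} (R : L.Rel n σ)
    (a : ∀ i, M.Carrier (σ i)), M.rel R a ↔ M.rel R (fun i => g (σ i) (a i))

variable (M) in
/-- `M` is a monster model with respect to `κ`: it is `κ`-saturated and strongly
`κ`-homogeneous, where `κ` is greater than `ℵ₀` and than the cardinality of the language.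
Subsets of cardinality less than `κ` are called small. -/
structure IsMonster (κ : Cardinal.{u}) : Prop where
  aleph0_lt : Cardinal.aleph0 < κ
  card_lt : L.card < κ
  saturated : ∀ (A : M.SSet), A.card < κ → ∀ (s : L.Sorts) (P : Set (Set (M.Carrier s))),
    (∀ X ∈ P, DefinableOver A X) → (∀ Q ⊆ P, Q.Finite → (⋂₀ Q).Nonempty) → (⋂₀ P).Nonempty
  homogeneous : ∀ (A : M.SSet), A.card < κ → ∀ f : (∀ s, A s → M.Carrier s), IsElementary f →
    ∃ g : ∀ s, Equiv.Perm (M.Carrier s), M.IsAut g ∧ ∀ s (a : A s), g s a = f s a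

/-! Galois groups. -/

/-- `Aut(B/A)`: the group of elementary permutations of `B` that fix `A ∩ B` pointwise. If
`Th(M)` has quantifier elimination and `B` is a substructure, elementary permutations of `B` are
the same as automorphisms of the structure `B`. -/
def aut (B A : M.SSet) : Subgroup (∀ s, Equiv.Perm (B s)) where
  carrier := {g | IsElementary (fun s (b : B s) => (g s b : M.Carrier s)) ∧
    ∀ s (b : B s), (b : M.Carrier s) ∈ A s → g s b = b}
  mul_mem' := by
    rintro g h ⟨hg, hg'⟩ ⟨hh, hh'⟩
    refine ⟨fun n σ φ a => ?_, fun s b hb => ?_⟩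
    · exact (hh n σ φ a).trans (hg n σ φ (fun i => h (σ i) (a i)))
    · change g s (h s b) = b
      rw [hh' s b hb, hg' s b hb]
  one_mem' := ⟨fun _ _ _ _ => Iff.rfl, fun _ _ _ => rfl⟩
  inv_mem' := by
    rintro g ⟨hg, hg'⟩
    refine ⟨fun n σ φ a => ?_, fun s b hb => ?_⟩
    · have key := hg n σ φ (fun i => (g (σ i)).symm (a i))
      simp only [Equiv.apply_symm_apply] at key
      exact key.symm
    · change (g s).symm b = b
      rw [Equiv.symm_apply_eq, hg' s b hb]

/-- The topology of pointwise convergence on `Aut(B/A)`, for the discrete topology on `B`. -/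
instance (B A : M.SSet) : TopologicalSpace (aut B A) :=
  TopologicalSpace.induced (fun g (x : Σ s, B s) => g.1 x.1 x.2)
    (@Pi.topologicalSpace (Σ s, B s) (fun x => B x.1) (fun _ => ⊥))

/-- `G(B/A) = Aut(dcl(B)/dcl(A))`. -/
abbrev gal (B A : M.SSet) : Subgroup (∀ s, Equiv.Perm (dcl B s)) := aut (dcl B) (dcl A)

/-- The absolute Galois group `G(A) = Aut(acl(A)/dcl(A))`. -/
abbrev absGal (A : M.SSet) : Subgroup (∀ s, Equiv.Perm (acl A s)) := aut (acl A) (dcl A)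

/-- The fixed set `acl(K)^N` of a subgroup `N` of `G(K)`. -/
def fixedSet (K : M.SSet) (N : Subgroup (absGal K)) : M.SSet :=
  fun s => {x | ∃ hx : x ∈ acl K s, ∀ g ∈ N, (g.1 s ⟨x, hx⟩ : M.Carrier s) = x}

/-- `K ⊆ L` is a Galois extension: `L` is definably closed, contained in `acl(K)`, and stable
under the automorphisms of `M` over `K`. -/
structure IsGaloisExt (K L' : M.SSet) : Prop where
  le : K ≤ L'
  dcl_eq : dcl L' = L'
  le_acl : L' ≤ acl K
  normal : ∀ g : (∀ s, Equiv.Perm (M.Carrier s)), M.IsAut g → (∀ s, ∀ x ∈ K s, g s x = x) →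
    ∀ s, ∀ x ∈ L' s, g s x ∈ L' s

/-- `a ∈ e(L/K)`: `a` is a primitive element of the Galois extension `K ⊆ L`. -/
def IsPrimitive (K L' : M.SSet) {s : L.Sorts} (a : M.Carrier s) : Prop :=
  IsGaloisExt K L' ∧ L' = dcl (adjoin K a)

/-- The action of `G(B/A)` on `S_J(B) = S₁(B) × ⋯ × Sₖ(B)`, for `J = (S₁, …, Sₖ)` and definably
closed `B`. -/
def galToPerm (B A : M.SSet) {k : ℕ} (J : Fin k → L.Sorts) :
    gal B A →* Equiv.Perm (∀ i, dcl B (J i)) where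
  toFun g := Equiv.piCongrRight (fun i => g.1 (J i))
  map_one' := rfl
  map_mul' _ _ := rfl

/-- `Aut_J(B/A)`: the image of `G(B/A)` in the permutation group of `S_J(B)`. -/
def autJ (B A : M.SSet) {k : ℕ} (J : Fin k → L.Sorts) :
    Subgroup (Equiv.Perm (∀ i, dcl B (J i))) :=
  (galToPerm B A J).range

/-- `J ∈ ℱ(N)`, that is, `|Aut_J(acl(K)^N/K)| = |G(acl(K)^N/K)|`. -/
def MemF (K : M.SSet) (N : Subgroup (absGal K)) {k : ℕ} (J : Fin k → L.Sorts) : Prop :=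
  Cardinal.mk (autJ (fixedSet K N) K J) = Cardinal.mk (gal (fixedSet K N) K)

/-- A homomorphism `π : G(F) → G(E)` is sorted: it is a continuous epimorphism, and
`ℱ(N) ⊆ ℱ(π⁻¹[N])` for every open normal subgroup `N` of `G(E)`. -/
structure IsSorted {E F : M.SSet} (π : absGal F →* absGal E) : Prop where
  continuous : Continuous π
  surjective : Function.Surjective π
  memF : ∀ N : Subgroup (absGal E), N.Normal → IsOpen (N : Set (absGal E)) →
    ∀ (k : ℕ) (J : Fin k → L.Sorts), MemF E N J → MemF F (N.comap π) J

/-- `E ⊆ F` is a regular extension: `dcl(F) ∩ acl(E) = dcl(E)`. -/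
structure IsRegularExt (E F : M.SSet) : Prop where
  le : E ≤ F
  dcl_inf_acl : dcl F ⊓ acl E = dcl E

/-! The restriction map between absolute Galois groups. -/

theorem DefinableOver.mono {A B : M.SSet} (h : A ≤ B) {s : L.Sorts} {X : Set (M.Carrier s)}
    (hX : DefinableOver A X) : DefinableOver B X := by
  obtain ⟨n, τ, φ, e, rfl⟩ := hX
  exact ⟨n, τ, φ, fun i => ⟨e i, h _ (e i).2⟩, rfl⟩

theorem dcl_mono {A B : M.SSet} (h : A ≤ B) : dcl A ≤ dcl B := fun _ _ ha => ha.mono h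

theorem acl_mono {A B : M.SSet} (h : A ≤ B) : acl A ≤ acl B :=
  fun _ _ ⟨X, hX, hf, ha⟩ => ⟨X, hX.mono h, hf, ha⟩

theorem le_dcl (A : M.SSet) : A ≤ dcl A := by
  intro s a ha
  refine ⟨1, fun _ => s, .equal (s := s) (.var (σ := Fin.cons s fun _ => s) 0)
    (.var (σ := Fin.cons s fun _ => s) 1), fun _ => ⟨a, ha⟩, ?_⟩
  ext x
  exact Iff.rfl

theorem dcl_le_acl (A : M.SSet) : dcl A ≤ acl A :=
  fun _ a ha => ⟨{a}, ha, Set.finite_singleton a, rfl⟩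

/-- An element of `G(F)` maps `acl(E)` into itself if `E ⊆ F`. -/
theorem absGal_apply_mem {E F : M.SSet} (h : E ≤ F) (g : absGal F) {s : L.Sorts}
    (x : acl F s) (hx : (x : M.Carrier s) ∈ acl E s) : (g.1 s x : M.Carrier s) ∈ acl E s := by
  obtain ⟨X, ⟨n, τ, φ, e, rfl⟩, hfin, hxX⟩ := hx
  refine ⟨_, ⟨n, τ, φ, e, rfl⟩, hfin, ?_⟩
  have hdcl : ∀ i, (e i : M.Carrier (τ i)) ∈ dcl F (τ i) := fun i =>
    le_dcl F _ (h _ (e i).2)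
  let e' : ∀ i, acl F (τ i) := fun i => ⟨e i, dcl_le_acl F _ (hdcl i)⟩
  have key := g.2.1 (n + 1) (Fin.cons s τ) φ (tupleCons (X := fun t => acl F t) x e')
  have h1 : (fun i => (tupleCons (X := fun t => acl F t) x e' i :
        M.Carrier ((Fin.cons s τ : Fin (n + 1) → L.Sorts) i))) =
      tupleCons (X := M.Carrier) (x : M.Carrier s) (fun i => (e i : M.Carrier (τ i))) := by
    funext i
    refine Fin.cases rfl (fun j => rfl) i
  have h2 : (fun i => (g.1 _ (tupleCons (X := fun t => acl F t) x e' i) :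
        M.Carrier ((Fin.cons s τ : Fin (n + 1) → L.Sorts) i))) =
      tupleCons (X := M.Carrier) (g.1 s x : M.Carrier s)
        (fun i => (e i : M.Carrier (τ i))) := by
    funext i
    refine Fin.cases rfl (fun j => ?_) i
    exact congrArg Subtype.val (g.2.2 (τ j) (e' j) (hdcl j))
  rw [h1, h2] at key
  exact key.1 hxX

/-- The restriction map `G(F) → G(E)`, `g ↦ g|acl(E)`, for `E ⊆ F`. -/
def res {E F : M.SSet} (h : E ≤ F) : absGal F →* absGal E where
  toFun g :=
    ⟨fun s =>
      { toFun := fun x => ⟨g.1 s ⟨x, acl_mono h s x.2⟩, absGal_apply_mem h g _ x.2⟩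
        invFun := fun x => ⟨(g.1 s).symm ⟨x, acl_mono h s x.2⟩, absGal_apply_mem h g⁻¹ _ x.2⟩
        left_inv := fun x => Subtype.ext (congrArg (fun y : acl F s => (y : M.Carrier s))
          ((g.1 s).symm_apply_apply ⟨x, acl_mono h s x.2⟩))
        right_inv := fun x => Subtype.ext (congrArg (fun y : acl F s => (y : M.Carrier s))
          ((g.1 s).apply_symm_apply ⟨x, acl_mono h s x.2⟩)) },
      fun n σ φ a => g.2.1 n σ φ (fun i => ⟨a i, acl_mono h _ (a i).2⟩),
      fun s b hb => Subtype.ext (congrArg (fun y : acl F s => (y : M.Carrier s))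
        (g.2.2 s ⟨b, acl_mono h s b.2⟩ (dcl_mono h s hb)))⟩
  map_one' := rfl
  map_mul' _ _ := rfl

end Struct

end MSLanguage

/-! Everything is read off from automorphisms of the monster. Over a small set `A`, an element is
definable iff every automorphism over `A` fixes it, and algebraic iff its orbit is finite. Since
`acl A` is again small, homogeneity makes the elements of `absGal A` exactly the restrictions of
automorphisms over `A`.

The core is a Galois correspondence, `IsMonster.exists_mem_eqOn`. Let `H` be a group of
automorphisms over `E`, and let `h` over `E` fix each point of `acl E` fixed by `H`. The `H`-orbit
of a finite tuple `b` from `acl E` is a finite set, which has a code by elimination of imaginaries.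
The code lies in `acl E` and is fixed by `H`, hence by `h`; so `h` preserves the orbit and agrees on
`b` with some element of `H`.

It is used twice. For `H` the automorphisms over `F`, the fixed points in `acl E` form `dcl F ⊓ acl
E`, which is `dcl E` by regularity. So any `σ` in `absGal E` is, on each finite set, induced by an
automorphism over `F`; hence `σ` together with the identity on `F` is elementary and extends
(`IsMonster.surjective_res`). For `H` the lifts of an open `N`, it shows that whatever fixes
`fixedSet E N` pointwise lies in `N`.

The second use yields the rest: an automorphism over `F` that fixes `fixedSet E N` restricts into
`π⁻¹[N]`, so it fixes `fixedSet F (π⁻¹[N])`. This transfers primitive elements, and it transfers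
faithfulness of the action on `S_J`, which is what membership in `ℱ(N)` means because the Galois
group of `fixedSet E N` over `E` is finite. -/

namespace MSLanguage

variable {L : MSLanguage.{u}}

/-! ### Substitution in terms and formulas. -/

/-- The variable `i`, as a term of a sort `s` equal to the sort of `i`. -/
def Term.varOf {n : ℕ} {σ : Fin n → L.Sorts} {s : L.Sorts} (i : Fin n) (h : σ i = s) :
    L.Term σ s := h ▸ .var i

theorem Term.val_varOf_heq (M : L.Struct) {n : ℕ} {σ : Fin n → L.Sorts} {s : L.Sorts} (i : Fin n)
    (h : σ i = s) (v : ∀ i, M.Carrier (σ i)) : HEq ((Term.varOf i h).val M v) (v i) := by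
  subst h; rfl

/-- Simultaneous substitution in a term. -/
def Term.subst {n m : ℕ} {σ : Fin n → L.Sorts} {τ : Fin m → L.Sorts}
    (t : ∀ i, L.Term τ (σ i)) : ∀ {s : L.Sorts}, L.Term σ s → L.Term τ s
  | _, .var i => t i
  | _, .app f a => .app f (fun i => (a i).subst t)

/-- The extension of a substitution below a quantifier. -/
def liftSubst {n m : ℕ} {σ : Fin n → L.Sorts} {τ : Fin m → L.Sorts} (s : L.Sorts)
    (t : ∀ i, L.Term τ (σ i)) : ∀ i, L.Term (Fin.cons s τ : Fin (m + 1) → L.Sorts)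
      ((Fin.cons s σ : Fin (n + 1) → L.Sorts) i) :=
  Fin.cases (.var (σ := (Fin.cons s τ : Fin (m + 1) → L.Sorts)) 0)
    (fun i => (t i).subst (fun j => .var (σ := (Fin.cons s τ : Fin (m + 1) → L.Sorts)) j.succ))

/-- Simultaneous substitution in a formula. -/
def Formula.subst : ∀ {n m : ℕ} {σ : Fin n → L.Sorts} {τ : Fin m → L.Sorts}
    (_ : ∀ i, L.Term τ (σ i)), L.Formula n σ → L.Formula m τ
  | _, _, _, _, _, .falsum => .falsum
  | _, _, _, _, t, .equal a b => .equal (a.subst t) (b.subst t)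
  | _, _, _, _, t, .rel R a => .rel R (fun i => (a i).subst t)
  | _, _, _, _, t, .imp φ ψ => .imp (φ.subst t) (ψ.subst t)
  | _, _, _, _, t, .all s φ => .all s (φ.subst (liftSubst s t))

theorem Term.val_subst (M : L.Struct) {n m : ℕ} {σ : Fin n → L.Sorts} {τ : Fin m → L.Sorts}
    (t : ∀ i, L.Term τ (σ i)) (v : ∀ i, M.Carrier (τ i)) {s : L.Sorts} (a : L.Term σ s) :
    (a.subst t).val M v = a.val M (fun i => (t i).val M v) := by
  induction a with
  | var i => rfl
  | app f a ih => simp only [Term.subst, Term.val, ih]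

theorem Formula.realize_subst (M : L.Struct) {n m : ℕ} {σ : Fin n → L.Sorts}
    {τ : Fin m → L.Sorts} (t : ∀ i, L.Term τ (σ i)) (φ : L.Formula n σ)
    (v : ∀ i, M.Carrier (τ i)) :
    (φ.subst t).Realize M v ↔ φ.Realize M (fun i => (t i).val M v) := by
  induction φ generalizing m with
  | falsum => rfl
  | equal a b => simp only [Formula.subst, Formula.Realize, Term.val_subst]
  | rel R a => simp only [Formula.subst, Formula.Realize, Term.val_subst]
  | imp φ ψ ih₁ ih₂ => simp only [Formula.subst, Formula.Realize, ih₁, ih₂]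
  | all s φ ih =>
    simp only [Formula.subst, Formula.Realize, ih]
    refine forall_congr' fun a => ?_
    have : (fun i => (liftSubst s t i).val M (tupleCons (X := M.Carrier) a v)) =
        tupleCons (X := M.Carrier) a (fun i => (t i).val M v) := by
      funext i
      refine Fin.cases rfl (fun j => ?_) i
      exact Term.val_subst M _ _ (t j)
    rw [this]

namespace Struct

variable {M : L.Struct}

theorem SSet.sigma_val_injective (A : M.SSet) : Function.Injective
    (fun p : Σ s, A s => (⟨p.1, p.2⟩ : Σ s, M.Carrier s)) := by
  rintro ⟨s, x⟩ ⟨t, y⟩ h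
  obtain ⟨h₁, h₂⟩ := Sigma.mk.inj h
  dsimp only at h₁
  subst h₁
  exact congrArg (Sigma.mk s) (Subtype.ext (eq_of_heq h₂))

/-! ### Relations definable without parameters, on arbitrary families of variables. -/

/-- A relation between elements of sorts `σ i` is definable without parameters; the index type may
live in any universe. -/
def Dfn {ι : Type*} (σ : ι → L.Sorts) (R : (∀ i, M.Carrier (σ i)) → Prop) : Prop :=
  ∃ (n : ℕ) (e : Fin n → ι) (φ : L.Formula n (fun k => σ (e k))),
    ∀ v, R v ↔ φ.Realize M (fun k => v (e k))

namespace Dfn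

variable {ι : Type*} {σ : ι → L.Sorts} {R R' : (∀ i, M.Carrier (σ i)) → Prop}

theorem congr (h : Dfn σ R) (h' : ∀ v, R v ↔ R' v) : Dfn σ R' := by
  obtain rfl : R = R' := funext fun v => propext (h' v)
  exact h

theorem false : Dfn (M := M) σ (fun _ => False) :=
  ⟨0, Fin.elim0, .falsum, fun _ => Iff.rfl⟩

/-- The two variable lists are concatenated and each formula is pulled back to its half. Sorts then
agree only propositionally, hence `Term.varOf` and `HEq`. -/
theorem imp (h : Dfn σ R) (h' : Dfn σ R') : Dfn σ (fun v => R v → R' v) := by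
  obtain ⟨n, e, φ, hφ⟩ := h
  obtain ⟨m, d, ψ, hψ⟩ := h'
  have he (k : Fin n) : Fin.append e d (Fin.castAdd m k) = e k := Fin.append_left ..
  have hd (k : Fin m) : Fin.append e d (Fin.natAdd n k) = d k := Fin.append_right ..
  refine ⟨n + m, Fin.append e d,
    .imp (φ.subst fun k => Term.varOf (Fin.castAdd m k) (congrArg σ (he k)))
      (ψ.subst fun k => Term.varOf (Fin.natAdd n k) (congrArg σ (hd k))), fun v => ?_⟩
  simp only [Formula.Realize, Formula.realize_subst, hφ, hψ]
  have h₁ : (fun k => v (e k)) = fun k => (Term.varOf (Fin.castAdd m k)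
      (congrArg σ (he k))).val M (fun k => v (Fin.append e d k)) := by
    funext k
    refine eq_of_heq (HEq.trans ?_ (Term.val_varOf_heq ..).symm)
    rw [he]
  have h₂ : (fun k => v (d k)) = fun k => (Term.varOf (Fin.natAdd n k)
      (congrArg σ (hd k))).val M (fun k => v (Fin.append e d k)) := by
    funext k
    refine eq_of_heq (HEq.trans ?_ (Term.val_varOf_heq ..).symm)
    rw [hd]
  rw [h₁, h₂]

theorem not (h : Dfn σ R) : Dfn σ (fun v => ¬ R v) := h.imp .false

theorem true : Dfn (M := M) σ (fun _ => True) := Dfn.false.not.congr fun _ => by simp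

theorem and (h : Dfn σ R) (h' : Dfn σ R') : Dfn σ (fun v => R v ∧ R' v) :=
  (h.imp h'.not).not.congr fun _ => by simp

theorem forall_finite {κ : Type*} [Finite κ] {R : κ → (∀ i, M.Carrier (σ i)) → Prop}
    (h : ∀ k, Dfn σ (R k)) : Dfn σ (fun v => ∀ k, R k v) := by
  have key (S : Set κ) : Dfn σ (fun v => ∀ k ∈ S, R k v) := by
    induction S, S.toFinite using Set.Finite.induction_on with
    | empty => exact Dfn.true.congr fun _ => by simp
    | @insert k _ _ _ ih => exact ((h k).and ih).congr fun v => by simp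
  exact (key Set.univ).congr fun v => by simp

theorem exists_finite {κ : Type*} [Finite κ] {R : κ → (∀ i, M.Carrier (σ i)) → Prop}
    (h : ∀ k, Dfn σ (R k)) : Dfn σ (fun v => ∃ k, R k v) :=
  (forall_finite fun k => (h k).not).not.congr fun v => by simp

theorem heq (i j : ι) (h : σ j = σ i) : Dfn (M := M) σ (fun v => HEq (v i) (v j)) := by
  refine ⟨2, ![i, j], .equal (.var 0) (Term.varOf 1 h), fun v => ?_⟩
  have := Term.val_varOf_heq M (σ := fun k => σ (![i, j] k)) 1 h (fun k => v (![i, j] k))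
  exact ⟨fun e => eq_of_heq (HEq.trans e this.symm), fun e => HEq.trans (heq_of_eq e) this⟩

end Dfn

/-! ### Sets definable with parameters. -/

/-- The sort of a parameter in `A`, or of an additional variable of sort `s`. -/
def optSort (A : M.SSet) (s : L.Sorts) : Option (Σ t, A t) → L.Sorts
  | none => s
  | some p => p.1

/-- The value of a parameter in `A`, or `x`. -/
def optVal (A : M.SSet) {s : L.Sorts} (x : M.Carrier s) :
    ∀ o : Option (Σ t, A t), M.Carrier (optSort A s o)
  | none => x
  | some p => p.2.1

/-- Occurrences of `none` become variable `0`; the remaining ones are enumerated and become the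
parameter tuple. With the converse `DefinableOver.exists_dfn`, this carries Boolean operations over
from `Dfn`. -/
theorem definableOver_of_dfn {A : M.SSet} {s : L.Sorts}
    {R : (∀ o, M.Carrier (optSort A s o)) → Prop} (h : Dfn (optSort A s) R) :
    DefinableOver A {x : M.Carrier s | R (optVal A x)} := by
  classical
  obtain ⟨n, e, φ, hφ⟩ := h
  let e' := Fintype.equivFin {k : Fin n // e k ≠ none}
  choose p hp using fun k : {k : Fin n // e k ≠ none} => Option.ne_none_iff_exists'.1 k.2
  let τ : Fin (Fintype.card {k : Fin n // e k ≠ none}) → L.Sorts := fun i => (p (e'.symm i)).1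
  have h₀ (k : Fin n) (hk : e k = none) :
      (Fin.cons s τ : Fin (_ + 1) → L.Sorts) 0 = optSort A s (e k) := by rw [hk]; rfl
  have h₁ (k : Fin n) (hk : e k ≠ none) : (Fin.cons s τ : Fin (_ + 1) → L.Sorts)
      (e' ⟨k, hk⟩).succ = optSort A s (e k) := by
    rw [hp ⟨k, hk⟩, Fin.cons_succ]
    simp only [τ, Equiv.symm_apply_apply]
    rfl
  refine ⟨_, τ, φ.subst (fun k => if hk : e k = none then Term.varOf 0 (h₀ k hk)
    else Term.varOf (e' ⟨k, hk⟩).succ (h₁ k hk)), fun i => (p (e'.symm i)).2, ?_⟩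
  ext x
  simp only [Set.mem_ofPred_eq, hφ, Formula.realize_subst]
  refine iff_of_eq (congrArg _ (funext fun k => eq_of_heq ?_))
  split_ifs with hk
  · refine HEq.trans ?_ (Term.val_varOf_heq ..).symm
    rw [hk]; rfl
  · refine HEq.trans ?_ (Term.val_varOf_heq ..).symm
    rw [hp ⟨k, hk⟩]
    change HEq (p ⟨k, hk⟩).2.1 (p (e'.symm (e' ⟨k, hk⟩))).2.1
    rw [Equiv.symm_apply_apply]

theorem DefinableOver.exists_dfn {A : M.SSet} {s : L.Sorts} {X : Set (M.Carrier s)}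
    (h : DefinableOver A X) : ∃ R : (∀ o, M.Carrier (optSort A s o)) → Prop,
      Dfn (optSort A s) R ∧ X = {x | R (optVal A x)} := by
  obtain ⟨n, τ, φ, e, rfl⟩ := h
  let j : Fin (n + 1) → Option (Σ t, A t) := Fin.cases none (fun i => some ⟨τ i, e i⟩)
  have hj (k : Fin (n + 1)) : optSort A s (j k) = (Fin.cons s τ : Fin (n + 1) → L.Sorts) k := by
    refine Fin.cases rfl (fun i => rfl) k
  refine ⟨_, ⟨n + 1, j, φ.subst fun k => Term.varOf k (hj k), fun v => Iff.rfl⟩, ?_⟩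
  ext x
  simp only [Set.mem_ofPred_eq, Formula.realize_subst]
  refine iff_of_eq (congrArg _ (funext fun k => eq_of_heq ?_))
  refine HEq.trans ?_ (Term.val_varOf_heq ..).symm
  exact Fin.cases HEq.rfl (fun i => HEq.rfl) k

theorem DefinableOver.inter {A : M.SSet} {s : L.Sorts} {X Y : Set (M.Carrier s)}
    (hX : DefinableOver A X) (hY : DefinableOver A Y) : DefinableOver A (X ∩ Y) := by
  obtain ⟨R, hR, rfl⟩ := hX.exists_dfn
  obtain ⟨R', hR', rfl⟩ := hY.exists_dfn
  exact definableOver_of_dfn (hR.and hR')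

theorem DefinableOver.compl {A : M.SSet} {s : L.Sorts} {X : Set (M.Carrier s)}
    (hX : DefinableOver A X) : DefinableOver A Xᶜ := by
  obtain ⟨R, hR, rfl⟩ := hX.exists_dfn
  exact definableOver_of_dfn hR.not

theorem DefinableOver.univ (A : M.SSet) (s : L.Sorts) :
    DefinableOver A (Set.univ : Set (M.Carrier s)) := definableOver_of_dfn Dfn.true

theorem DefinableOver.sInter {A : M.SSet} {s : L.Sorts} {Q : Set (Set (M.Carrier s))}
    (hQ : Q.Finite) (h : ∀ X ∈ Q, DefinableOver A X) : DefinableOver A (⋂₀ Q) := by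
  induction Q, hQ using Set.Finite.induction_on with
  | empty => rw [Set.sInter_empty]; exact .univ A s
  | insert _ _ ih =>
    rw [Set.sInter_insert]
    exact (h _ (Set.mem_insert ..)).inter (ih fun X hX => h X (Set.mem_insert_of_mem _ hX))

end Struct
end MSLanguage

/-! ### Counting formulas, and smallness of algebraic closures. -/

namespace MSLanguage

variable {L : MSLanguage.{u}}

/-- The nodes of the syntax trees of terms and formulas: variables, function symbols, falsum,
equality, relation symbols, implication, and quantifiers. -/
inductive SyntaxNode (L : MSLanguage.{u}) : Type u
  | var (i : ℕ)
  | func (f : Σ (n : ℕ) (σ : Fin n → L.Sorts) (s : L.Sorts), L.Func n σ s)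
  | falsum
  | equal (s : L.Sorts)
  | rel (R : Σ (n : ℕ) (σ : Fin n → L.Sorts), L.Rel n σ)
  | imp
  | all (s : L.Sorts)

/-- The number of children of a node of a syntax tree. -/
def SyntaxNode.arity : L.SyntaxNode → ℕ
  | .var _ => 0
  | .func f => f.1
  | .falsum => 0
  | .equal _ => 2
  | .rel R => R.1
  | .imp => 2
  | .all _ => 1

/-- Syntax trees. -/
abbrev SyntaxTree (L : MSLanguage.{u}) : Type u :=
  WType (fun a : L.SyntaxNode => Fin a.arity)

/-- The syntax tree of a term. -/
def Term.tree {n : ℕ} {σ : Fin n → L.Sorts} : ∀ {s : L.Sorts}, L.Term σ s → L.SyntaxTree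
  | _, .var i => ⟨.var i, Fin.elim0⟩
  | s, .app (m := m) (τ := τ) f t => ⟨.func ⟨m, τ, s, f⟩, fun i => (t i).tree⟩

/-- The syntax tree of a formula. -/
def Formula.tree : ∀ {n : ℕ} {σ : Fin n → L.Sorts}, L.Formula n σ → L.SyntaxTree
  | _, _, .falsum => ⟨.falsum, Fin.elim0⟩
  | _, _, .equal (s := s) a b => ⟨.equal s, ![a.tree, b.tree]⟩
  | _, _, .rel (m := m) (τ := τ) R t => ⟨.rel ⟨m, τ, R⟩, fun i => (t i).tree⟩
  | _, _, .imp φ ψ => ⟨.imp, ![φ.tree, ψ.tree]⟩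
  | _, _, .all s φ => ⟨.all s, ![φ.tree]⟩

/-- The sorts may differ a priori so that case distinction on `b` has a free index; the tree
determines the sort. -/
theorem Term.tree_inj {n : ℕ} {σ : Fin n → L.Sorts} {s s' : L.Sorts} (a : L.Term σ s)
    (b : L.Term σ s') (h : a.tree = b.tree) : s = s' ∧ HEq a b := by
  induction a generalizing s' with
  | var i =>
    cases b with
    | var j =>
      obtain rfl := Fin.ext (SyntaxNode.var.inj (WType.mk.inj h).1)
      exact ⟨rfl, HEq.rfl⟩
    | app f t => cases (WType.mk.inj h).1
  | app f t ih =>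
    cases b with
    | var j => cases (WType.mk.inj h).1
    | app f' t' =>
      obtain ⟨rfl, h₁⟩ := Sigma.mk.inj (SyntaxNode.func.inj (WType.mk.inj h).1)
      obtain ⟨rfl, h₁⟩ := Sigma.mk.inj (eq_of_heq h₁)
      obtain ⟨rfl, h₁⟩ := Sigma.mk.inj (eq_of_heq h₁)
      obtain rfl := eq_of_heq h₁
      obtain rfl : t = t' := funext fun i =>
        eq_of_heq (ih i (t' i) (congrFun (eq_of_heq (WType.mk.inj h).2) i)).2
      exact ⟨rfl, HEq.rfl⟩

theorem Term.tree_injective {n : ℕ} {σ : Fin n → L.Sorts} {s : L.Sorts} :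
    Function.Injective (Term.tree : L.Term σ s → L.SyntaxTree) :=
  fun a b h => eq_of_heq (a.tree_inj b h).2

theorem Formula.tree_injective {n : ℕ} {σ : Fin n → L.Sorts} :
    Function.Injective (Formula.tree : L.Formula n σ → L.SyntaxTree) := by
  intro φ ψ h
  induction φ with
  | falsum =>
    cases ψ with
    | falsum => rfl
    | _ => cases (WType.mk.inj h).1
  | equal a b =>
    cases ψ with
    | equal a' b' =>
      obtain rfl := SyntaxNode.equal.inj (WType.mk.inj h).1
      have h := eq_of_heq (WType.mk.inj h).2
      rw [Term.tree_injective (congrFun h (0 : Fin 2)),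
        Term.tree_injective (congrFun h (1 : Fin 2))]
    | _ => cases (WType.mk.inj h).1
  | rel R t =>
    cases ψ with
    | rel R' t' =>
      obtain ⟨rfl, h₁⟩ := Sigma.mk.inj (SyntaxNode.rel.inj (WType.mk.inj h).1)
      obtain ⟨rfl, h₁⟩ := Sigma.mk.inj (eq_of_heq h₁)
      obtain rfl := eq_of_heq h₁
      obtain rfl : t = t' := funext fun i =>
        Term.tree_injective (congrFun (eq_of_heq (WType.mk.inj h).2) i)
      rfl
    | _ => cases (WType.mk.inj h).1
  | imp φ₁ φ₂ ih₁ ih₂ =>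
    cases ψ with
    | imp ψ₁ ψ₂ =>
      have h := eq_of_heq (WType.mk.inj h).2
      rw [ih₁ (congrFun h (0 : Fin 2)), ih₂ (congrFun h (1 : Fin 2))]
    | _ => cases (WType.mk.inj h).1
  | all s φ ih =>
    cases ψ with
    | all s' ψ =>
      obtain rfl := SyntaxNode.all.inj (WType.mk.inj h).1
      rw [ih (congrFun (eq_of_heq (WType.mk.inj h).2) (0 : Fin 1))]
    | _ => cases (WType.mk.inj h).1

open Cardinal

theorem mk_sorts_le_card : #L.Sorts ≤ L.card :=
  (self_le_add_right _ _).trans (self_le_add_right _ _)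

/-- A W-type with finite arities is no larger than its set of nodes or `ℵ₀`, and nodes are numbers,
sorts or symbols. -/
theorem mk_syntaxTree_lt {κ : Cardinal.{u}} (h₀ : ℵ₀ < κ) (hL : L.card < κ) :
    #L.SyntaxTree < κ := by
  refine (WType.cardinalMk_le_max_aleph0_of_finite' (β := fun a : L.SyntaxNode => Fin a.arity)).trans_lt
    (max_lt ((lift_uzero _).trans_lt ?_) h₀)
  let f : L.SyntaxNode → (ULift.{u} ℕ ⊕ (Σ (n : ℕ) (σ : Fin n → L.Sorts) (s : L.Sorts),
      L.Func n σ s)) ⊕ (L.Sorts ⊕ (Σ (n : ℕ) (σ : Fin n → L.Sorts), L.Rel n σ)) ⊕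
        (L.Sorts ⊕ ULift.{u} ℕ)
    | .var i => .inl (.inl ⟨i⟩)
    | .func g => .inl (.inr g)
    | .falsum => .inr (.inr (.inr ⟨0⟩))
    | .equal s => .inr (.inl (.inl s))
    | .rel R => .inr (.inl (.inr R))
    | .imp => .inr (.inr (.inr ⟨1⟩))
    | .all s => .inr (.inr (.inl s))
  have hf : Function.Injective f := by
    rintro (_ | _ | _ | _ | _ | _ | _) (_ | _ | _ | _ | _ | _ | _) h <;> simp_all [f]
  refine (mk_le_of_injective hf).trans_lt ?_
  have hS := (mk_sorts_le_card (L := L)).trans_lt hL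
  have hfun : #(Σ (n : ℕ) (σ : Fin n → L.Sorts) (s : L.Sorts), L.Func n σ s) < κ :=
    ((self_le_add_left _ _).trans (self_le_add_right _ _)).trans_lt hL
  have hrel : #(Σ (n : ℕ) (σ : Fin n → L.Sorts), L.Rel n σ) < κ :=
    (self_le_add_left _ _).trans_lt hL
  have hN : #(ULift.{u} ℕ) < κ := by simpa using h₀
  simp only [mk_sum, lift_id]
  have := h₀.le
  exact add_lt_of_lt this (add_lt_of_lt this hN hfun)
    (add_lt_of_lt this (add_lt_of_lt this hS hrel) (add_lt_of_lt this hS hN))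

namespace Struct

variable {M : L.Struct}

theorem mk_sigma_le {ι : Type u} {α : ι → Type u} {c : Cardinal.{u}} (h : ∀ i, #(α i) ≤ c) :
    #(Σ i, α i) ≤ #ι * c := by
  rw [mk_sigma, ← sum_const']
  exact sum_le_sum _ _ h

/-- The formulas in one variable with parameters in `A`. -/
abbrev ParamFormula (A : M.SSet) : Type u :=
  Σ (s : L.Sorts) (n : ULift.{u} ℕ) (p : Fin n.down → Σ t, A t),
    L.Formula (n.down + 1) (Fin.cons s fun i => (p i).1)

/-- A parametrised formula amounts to a sort, a length, a finite list from `A` and a syntax tree.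
The maximum with `ℵ₀` bounds the lists also when `A` is finite. -/
theorem mk_paramFormula_lt {κ : Cardinal.{u}} (h₀ : ℵ₀ < κ) (hL : L.card < κ) {A : M.SSet}
    (hA : A.card < κ) : #(ParamFormula A) < κ := by
  refine (mk_sigma_le (c := ℵ₀ * (max ℵ₀ A.card * #L.SyntaxTree)) fun s => ?_).trans_lt ?_
  · refine (mk_sigma_le (c := max ℵ₀ A.card * #L.SyntaxTree) fun n => ?_).trans_eq (by simp)
    refine (mk_sigma_le fun p => mk_le_of_injective Formula.tree_injective).trans ?_
    refine mul_le_mul_left ?_ _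
    exact (mk_le_of_injective (List.ofFn_injective (n := n.down))).trans (mk_list_le_max _)
  · have := h₀.le
    exact mul_lt_of_lt this ((mk_sorts_le_card (L := L)).trans_lt hL) (mul_lt_of_lt this h₀
      (mul_lt_of_lt this (max_lt h₀ hA) (mk_syntaxTree_lt h₀ hL)))

/-- Sending an algebraic element to a formula that puts it in a finite set is a map with finite
fibres. Smallness of `acl A` lets homogeneity extend elements of `absGal A`. -/
theorem card_acl_lt {κ : Cardinal.{u}} (hM : M.IsMonster κ) {A : M.SSet} (hA : A.card < κ) :
    (acl A).card < κ := by
  have h₀ := hM.aleph0_lt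
  let val (d : ParamFormula A) : Set (Σ s, M.Carrier s) :=
    Sigma.mk d.1 '' {x | d.2.2.2.Realize M
      (tupleCons (X := M.Carrier) x (fun i => ((d.2.2.1 i).2 : M.Carrier _)))}
  have h (x : Σ s, acl A s) : ∃ d : ParamFormula A, (val d).Finite ∧ ⟨x.1, x.2⟩ ∈ val d := by
    obtain ⟨s, x, X, ⟨n, τ, φ, e, rfl⟩, hfin, hx⟩ := x
    exact ⟨⟨s, ⟨n⟩, fun i => ⟨τ i, e i⟩, φ⟩, hfin.image _, ⟨x, hx, rfl⟩⟩
  choose d hd hx using h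
  refine (mk_le_mk_mul_of_mk_preimage_le (c := ℵ₀) d fun b => ?_).trans_lt
    (mul_lt_of_lt h₀.le (mk_paramFormula_lt h₀ hM.card_lt hA) h₀)
  refine Set.Countable.le_aleph0 (Set.Finite.countable ?_)
  by_cases hb : (val b).Finite
  · refine Set.Finite.of_finite_image (f := fun x : Σ s, acl A s =>
      (⟨x.1, x.2⟩ : Σ s, M.Carrier s)) (hb.subset ?_)
      (SSet.sigma_val_injective _).injOn
    rintro _ ⟨x, rfl, rfl⟩
    exact hx x
  · convert Set.finite_empty
    ext x
    simp only [Set.mem_preimage, Set.mem_singleton_iff, Set.mem_empty_iff_false, iff_false]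
    rintro rfl
    exact hb (hd x)
/-! Automorphisms. -/

theorem IsAut.val {g : ∀ s, Equiv.Perm (M.Carrier s)} (hg : M.IsAut g) {n : ℕ}
    {σ : Fin n → L.Sorts} (v : ∀ i, M.Carrier (σ i)) {s : L.Sorts} (t : L.Term σ s) :
    g s (t.val M v) = t.val M (fun i => g (σ i) (v i)) := by
  induction t with
  | var i => rfl
  | app f t ih => simp only [Term.val, hg.func, ih]

theorem apply_tupleCons (g : ∀ s, Equiv.Perm (M.Carrier s)) {n : ℕ} {σ : Fin n → L.Sorts}
    {s : L.Sorts} (a : M.Carrier s) (v : ∀ i, M.Carrier (σ i)) :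
    (fun i => g _ (tupleCons (X := M.Carrier) a v i)) =
      tupleCons (X := M.Carrier) (g s a) (fun i => g (σ i) (v i)) := by
  funext i
  exact Fin.cases rfl (fun j => rfl) i

theorem IsAut.realize {g : ∀ s, Equiv.Perm (M.Carrier s)} (hg : M.IsAut g) {n : ℕ}
    {σ : Fin n → L.Sorts} (φ : L.Formula n σ) (v : ∀ i, M.Carrier (σ i)) :
    φ.Realize M (fun i => g (σ i) (v i)) ↔ φ.Realize M v := by
  induction φ with
  | falsum => rfl
  | equal a b => simp only [Formula.Realize, ← hg.val, EmbeddingLike.apply_eq_iff_eq]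
  | rel R t => simp only [Formula.Realize, ← hg.val, ← hg.rel]
  | imp φ ψ ih₁ ih₂ => simp only [Formula.Realize, ih₁, ih₂]
  | all s φ ih =>
    simp only [Formula.Realize]
    refine (Equiv.forall_congr (g s) fun a => ?_).symm
    rw [← apply_tupleCons]
    exact (ih _).symm

/-- The automorphisms of `M` that fix `A` pointwise. -/
def fixAut (A : M.SSet) : Subgroup (∀ s, Equiv.Perm (M.Carrier s)) where
  carrier := {g | M.IsAut g ∧ ∀ s, ∀ x ∈ A s, g s x = x}
  mul_mem' := by
    rintro g h ⟨hg, hg'⟩ ⟨hh, hh'⟩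
    refine ⟨⟨fun f a => ?_, fun R a => ?_⟩, fun s x hx => ?_⟩
    · simp only [Pi.mul_apply, Equiv.Perm.mul_apply, hh.func, hg.func]
    · simp only [Pi.mul_apply, Equiv.Perm.mul_apply]
      exact (hh.rel R a).trans (hg.rel R _)
    · simp only [Pi.mul_apply, Equiv.Perm.mul_apply, hh' s x hx, hg' s x hx]
  one_mem' := ⟨⟨fun _ _ => rfl, fun _ _ => Iff.rfl⟩, fun _ _ _ => rfl⟩
  inv_mem' := by
    rintro g ⟨hg, hg'⟩
    refine ⟨⟨fun f a => ?_, fun R a => ?_⟩, fun s x hx => ?_⟩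
    · rw [Pi.inv_apply, Equiv.Perm.inv_eq_iff_eq, hg.func]
      simp
    · rw [hg.rel R (fun i => (g⁻¹) _ (a i))]
      simp
    · rw [Pi.inv_apply, Equiv.Perm.inv_eq_iff_eq, hg' s x hx]

theorem inv_apply_apply (g : ∀ s, Equiv.Perm (M.Carrier s)) {s : L.Sorts} (x : M.Carrier s) :
    g⁻¹ s (g s x) = x := (g s).symm_apply_apply x

theorem fixAut_anti {A B : M.SSet} (h : A ≤ B) : fixAut B ≤ fixAut A :=
  fun _ hg => ⟨hg.1, fun s x hx => hg.2 s x (h s hx)⟩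

theorem DefinableOver.apply_mem_iff {A : M.SSet} {s : L.Sorts} {X : Set (M.Carrier s)}
    (hX : DefinableOver A X) {g : ∀ s, Equiv.Perm (M.Carrier s)} (hg : g ∈ fixAut A)
    (x : M.Carrier s) : g s x ∈ X ↔ x ∈ X := by
  obtain ⟨n, τ, φ, e, rfl⟩ := hX
  simp only [Set.mem_ofPred_eq]
  rw [← hg.1.realize φ (tupleCons (X := M.Carrier) x _), apply_tupleCons]
  simp only [hg.2 _ _ (e _).2]

theorem finite_orbit_of_mem_acl {A : M.SSet} {s : L.Sorts} {x : M.Carrier s} (hx : x ∈ acl A s) :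
    {y | ∃ g ∈ fixAut A, g s x = y}.Finite := by
  obtain ⟨X, hX, hfin, hx⟩ := hx
  refine hfin.subset ?_
  rintro _ ⟨g, hg, rfl⟩
  exact (hX.apply_mem_iff hg x).2 hx

theorem apply_mem_acl {A : M.SSet} {g : ∀ s, Equiv.Perm (M.Carrier s)} (hg : g ∈ fixAut A)
    {s : L.Sorts} {x : M.Carrier s} (hx : x ∈ acl A s) : g s x ∈ acl A s := by
  obtain ⟨X, hX, hfin, hx⟩ := hx
  exact ⟨X, hX, hfin, (hX.apply_mem_iff hg x).2 hx⟩

theorem apply_eq_of_mem_dcl {A : M.SSet} {g : ∀ s, Equiv.Perm (M.Carrier s)} (hg : g ∈ fixAut A)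
    {s : L.Sorts} {x : M.Carrier s} (hx : x ∈ dcl A s) : g s x = x :=
  (DefinableOver.apply_mem_iff hx hg x).2 rfl

theorem fixAut_dcl (A : M.SSet) : fixAut (dcl A) = fixAut A :=
  le_antisymm (fixAut_anti (le_dcl A)) fun _ hg =>
    ⟨hg.1, fun _ _ hx => apply_eq_of_mem_dcl hg hx⟩

/-- An element of `dcl(B)` is fixed by the automorphisms fixing some finite tuple from `B`. -/
theorem exists_tuple_of_mem_dcl {B : M.SSet} {s : L.Sorts} {x : M.Carrier s} (hx : x ∈ dcl B s) :
    ∃ (n : ℕ) (b : Fin n → Σ t, B t), ∀ g, M.IsAut g →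
      (∀ i, g (b i).1 (b i).2 = (b i).2) → g s x = x := by
  obtain ⟨n, τ, φ, e, h⟩ := hx
  refine ⟨n, fun i => ⟨τ i, e i⟩, fun g hg hb => ?_⟩
  let B₀ : M.SSet := fun t => {y | ∃ i, (⟨t, y⟩ : Σ t, M.Carrier t) = ⟨τ i, e i⟩}
  have hx : x ∈ dcl B₀ s := ⟨n, τ, φ, fun i => ⟨e i, i, rfl⟩, h⟩
  refine apply_eq_of_mem_dcl ⟨hg, ?_⟩ hx
  rintro t y ⟨i, hi⟩
  obtain ⟨rfl, hi⟩ := Sigma.mk.inj hi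
  obtain rfl := eq_of_heq hi
  exact hb i

/-! Consequences of homogeneity and saturation. -/

/-- Homogeneity for families of elements. -/
theorem IsMonster.exists_aut {κ : Cardinal.{u}} (hM : M.IsMonster κ) {I : Type u}
    (hI : Cardinal.mk I < κ) {ρ : I → L.Sorts} {x y : ∀ i, M.Carrier (ρ i)}
    (h : ∀ R : (∀ i, M.Carrier (ρ i)) → Prop, Dfn ρ R → R x → R y) :
    ∃ g, M.IsAut g ∧ ∀ i, g (ρ i) (x i) = y i := by
  have h' : ∀ R : (∀ i, M.Carrier (ρ i)) → Prop, Dfn ρ R → (R x ↔ R y) := fun R hR =>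
    ⟨h R hR, fun hy => by_contra fun hx => h _ hR.not hx hy⟩
  -- The family `x` may repeat elements, so the map is defined on its set of entries by choosing one
  -- index `j` for each.
  let A : M.SSet := fun s => {z | ∃ i, (⟨ρ i, x i⟩ : Σ s, M.Carrier s) = ⟨s, z⟩}
  choose j hj using fun p : Σ s, A s => p.2.2
  have hA : A.card < κ := by
    refine (Cardinal.mk_le_of_injective (f := j) fun p q hpq => ?_).trans_lt hI
    exact SSet.sigma_val_injective A ((hj p).symm.trans
      ((congrArg (fun i => (⟨ρ i, x i⟩ : Σ s, M.Carrier s)) hpq).trans (hj q)))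
  have hs (p : Σ s, A s) : ρ (j p) = p.1 := congrArg Sigma.fst (hj p)
  have hv (p : Σ s, A s) : HEq (x (j p)) (p.2 : M.Carrier p.1) := (Sigma.mk.inj (hj p)).2
  let f : ∀ s, A s → M.Carrier s := fun s a =>
    cast (congrArg M.Carrier (hs ⟨s, a⟩)) (y (j ⟨s, a⟩))
  have hf (s : L.Sorts) (a : A s) : HEq (f s a) (y (j ⟨s, a⟩)) := cast_heq ..
  obtain ⟨g, hg, hgf⟩ := hM.homogeneous A hA f (fun n σ φ a => by
    have := h' _ ⟨n, fun k => j ⟨σ k, a k⟩,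
      φ.subst fun k => Term.varOf k (hs ⟨σ k, a k⟩), fun v => Iff.rfl⟩
    simp only [Formula.realize_subst] at this
    convert this using 2
    · exact funext fun k => eq_of_heq ((hv ⟨σ k, a k⟩).symm.trans
        (Term.val_varOf_heq M k (hs ⟨σ k, a k⟩) fun k => x (j ⟨σ k, a k⟩)).symm)
    · exact funext fun k => eq_of_heq ((hf _ (a k)).trans
        (Term.val_varOf_heq M k (hs ⟨σ k, a k⟩) fun k => y (j ⟨σ k, a k⟩)).symm))
  refine ⟨g, hg, fun i => ?_⟩
  let a : A (ρ i) := ⟨x i, i, rfl⟩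
  refine (hgf (ρ i) a).trans (eq_of_heq ((hf _ a).trans ?_))
  -- Independence of the chosen index: equality of two entries of `x` is a definable relation, so it
  -- passes to `y`.
  exact (h' _ (Dfn.heq (j ⟨ρ i, a⟩) i (hs ⟨ρ i, a⟩).symm)).1 (hv ⟨ρ i, a⟩)

/-- Elements of the same type over a small set are conjugate. -/
theorem IsMonster.exists_fixAut {κ : Cardinal.{u}} (hM : M.IsMonster κ) {A : M.SSet}
    (hA : A.card < κ) {s : L.Sorts} {x y : M.Carrier s}
    (h : ∀ X : Set (M.Carrier s), DefinableOver A X → x ∈ X → y ∈ X) :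
    ∃ g ∈ fixAut A, g s x = y := by
  have hI : Cardinal.mk (Option (Σ t, A t)) < κ := by
    rw [Cardinal.mk_option]
    exact Cardinal.add_lt_of_lt hM.aleph0_lt.le hA (Cardinal.one_lt_aleph0.trans hM.aleph0_lt)
  obtain ⟨g, hg, hxy⟩ := hM.exists_aut hI (ρ := optSort A s) (x := optVal A x) (y := optVal A y)
    fun R hR => h _ (definableOver_of_dfn hR)
  exact ⟨g, ⟨hg, fun t z hz => hxy (some ⟨t, z, hz⟩)⟩, hxy none⟩

/-- Elements with finitely many conjugates are algebraic. -/
theorem IsMonster.mem_acl {κ : Cardinal.{u}} (hM : M.IsMonster κ) {A : M.SSet}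
    (hA : A.card < κ) {s : L.Sorts} {x : M.Carrier s}
    (h : {y | ∃ g ∈ fixAut A, g s x = y}.Finite) : x ∈ acl A s := by
  by_contra hx
  set O := {y | ∃ g ∈ fixAut A, g s x = y} with hO
  let B : M.SSet := fun t => A t ∪ {y | ∃ o ∈ O, (⟨t, y⟩ : Σ t, M.Carrier t) = ⟨s, o⟩}
  have hAB : A ≤ B := fun t => Set.subset_union_left
  have hB : B.card < κ := by
    have hOκ : Cardinal.mk O < κ := h.lt_aleph0.trans hM.aleph0_lt
    refine (Cardinal.mk_le_of_surjective (α := (Σ t, A t) ⊕ O)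
      (f := Sum.elim (fun p => ⟨p.1, p.2, hAB _ p.2.2⟩)
        (fun o => ⟨s, o, Or.inr ⟨o, o.2, rfl⟩⟩)) ?_).trans_lt
      ((Cardinal.mk_sum _ _).trans_lt ?_)
    · rintro ⟨t, y, hy | ⟨o, ho, hy⟩⟩
      · exact ⟨.inl ⟨t, y, hy⟩, rfl⟩
      · obtain ⟨rfl, hy⟩ := Sigma.mk.inj hy
        obtain rfl := eq_of_heq hy
        exact ⟨.inr ⟨y, ho⟩, rfl⟩
    · rw [Cardinal.lift_id, Cardinal.lift_id]
      exact Cardinal.add_lt_of_lt hM.aleph0_lt.le hA hOκ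
  -- The type of `x` over `A` together with `≠ o` for all conjugates `o`. It is finitely
  -- satisfiable, since `A`-definable sets containing the non-algebraic `x` are infinite; but a
  -- realisation would be a conjugate outside `O`.
  let P : Set (Set (M.Carrier s)) :=
    {X | DefinableOver A X ∧ x ∈ X} ∪ (fun o => {o}ᶜ) '' O
  have hP : ∀ X ∈ P, DefinableOver B X := by
    rintro X (⟨hX, -⟩ | ⟨o, ho, rfl⟩)
    · exact hX.mono hAB
    · exact DefinableOver.compl (le_dcl B s (Or.inr ⟨o, ho, rfl⟩))
  have hne : ∀ Q ⊆ P, Q.Finite → (⋂₀ Q).Nonempty := by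
    intro Q hQ hfin
    let Q₀ := {X ∈ Q | DefinableOver A X ∧ x ∈ X}
    have hQ₀ : DefinableOver A (⋂₀ Q₀) :=
      .sInter (hfin.subset fun X hX => hX.1) fun X hX => hX.2.1
    have hinf : (⋂₀ Q₀).Infinite := fun hf => hx ⟨_, hQ₀, hf, fun X hX => hX.2.2⟩
    obtain ⟨y, hy, hyO⟩ := (hinf.sdiff h).nonempty
    refine ⟨y, fun X hX => ?_⟩
    obtain hX' | ⟨o, ho, rfl⟩ := hQ hX
    · exact hy X ⟨hX, hX'⟩
    · rintro rfl
      exact hyO ho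
  obtain ⟨y, hy⟩ := hM.saturated B hB s P hP hne
  obtain ⟨g, hg, hgy⟩ := hM.exists_fixAut hA (x := x) (y := y)
    fun X hX hx => hy X (Or.inl ⟨hX, hx⟩)
  exact hy _ (Or.inr ⟨y, ⟨g, hg, hgy⟩, rfl⟩) rfl

/-- Elements without other conjugates are definable. -/
theorem IsMonster.mem_dcl {κ : Cardinal.{u}} (hM : M.IsMonster κ) {A : M.SSet}
    (hA : A.card < κ) {s : L.Sorts} {x : M.Carrier s}
    (h : ∀ g ∈ fixAut A, g s x = x) : x ∈ dcl A s := by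
  have hx : x ∈ acl A s := hM.mem_acl hA <| (Set.finite_singleton x).subset <| by
    rintro _ ⟨g, hg, rfl⟩
    exact h g hg
  -- A smallest finite definable set containing `x` isolates the type of `x`, so all its elements
  -- are conjugate to `x`.
  obtain ⟨X, ⟨hX, hfin, hx⟩, hmin⟩ := exists_minimalFor_of_wellFoundedLT
    (fun X => DefinableOver A X ∧ X.Finite ∧ x ∈ X) Set.ncard hx
  have hXx : X = {x} := by
    refine Set.Subset.antisymm (fun y hy => ?_) (Set.singleton_subset_iff.2 hx)
    obtain ⟨g, hg, rfl⟩ := hM.exists_fixAut hA (x := x) (y := y) fun Y hY hxY => by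
      have := hmin (j := X ∩ Y) ⟨hX.inter hY, hfin.subset Set.inter_subset_left, hx, hxY⟩
        (Set.ncard_le_ncard Set.inter_subset_left hfin)
      rw [← Set.eq_of_subset_of_ncard_le Set.inter_subset_left this hfin] at hy
      exact hy.2
    exact h g hg
  change DefinableOver A {x}
  rwa [← hXx]

/-- If `y` is fixed by the automorphisms over `A` that fix a finite tuple from `acl(A)`, then
`y` is algebraic over `A`. -/
theorem IsMonster.mem_acl_of_tuple {κ : Cardinal.{u}} (hM : M.IsMonster κ) {A : M.SSet}
    (hA : A.card < κ) {ι : Type*} [Finite ι] (b : ι → Σ t, acl A t) {s : L.Sorts}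
    {y : M.Carrier s}
    (h : ∀ g ∈ fixAut A, (∀ i, g (b i).1 (b i).2 = (b i).2) → g s y = y) : y ∈ acl A s := by
  refine hM.mem_acl hA ?_
  let F : fixAut A → ∀ i, M.Carrier (b i).1 := fun g i => g.1 _ (b i).2
  have hF : (Set.range F).Finite := by
    refine (Set.Finite.pi' fun i => finite_orbit_of_mem_acl (b i).2.2).subset ?_
    rintro _ ⟨g, rfl⟩ i
    exact ⟨g.1, g.2, rfl⟩
  -- If `g` and `g'` agree on `b`, then `g⁻¹ * g'` fixes `b` and hence `y`. So the orbit of `y` is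
  -- an image of the finite orbit of `b`.
  have hfac : Function.FactorsThrough (fun g : fixAut A => g.1 s y) F := fun g g' hgg' => by
    have := h _ (mul_mem (inv_mem g.2) g'.2) fun i => by
      simp only [Pi.mul_apply, Equiv.Perm.mul_apply]
      rw [← show g.1 _ (b i).2.1 = g'.1 _ (b i).2.1 from congrFun hgg' i]
      exact inv_apply_apply _ _
    simp only [Pi.mul_apply, Equiv.Perm.mul_apply, Pi.inv_apply, Equiv.Perm.inv_eq_iff_eq] at this
    exact this.symm
  refine (hF.image (Function.extend F (fun g => g.1 s y) fun _ => y)).subset ?_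
  rintro _ ⟨g, hg, rfl⟩
  exact ⟨_, ⟨⟨g, hg⟩, rfl⟩, hfac.extend_apply _ _⟩

/-- An elementary permutation of a small set extends to an automorphism. -/
theorem IsMonster.exists_extension {κ : Cardinal.{u}} (hM : M.IsMonster κ) {A B : M.SSet}
    (hB : B.card < κ) (hAB : A ≤ B) (σ : aut B A) :
    ∃ g ∈ fixAut A, ∀ s (x : B s), g s x = σ.1 s x := by
  obtain ⟨g, hg, h⟩ := hM.homogeneous B hB _ σ.2.1
  exact ⟨g, ⟨hg, fun s x hx => (h s ⟨x, hAB s hx⟩).trans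
    (congrArg Subtype.val (σ.2.2 s ⟨x, hAB s hx⟩ hx))⟩, h⟩

/-- The restriction of an automorphism to an invariant set. -/
theorem exists_restriction {A B : M.SSet} {g : ∀ s, Equiv.Perm (M.Carrier s)} (hg : g ∈ fixAut A)
    (h : ∀ s x, g s x ∈ B s ↔ x ∈ B s) : ∃ σ : aut B A, ∀ s (x : B s), (σ.1 s x : M.Carrier s) = g s x :=
  ⟨⟨fun s => (g s).subtypePerm (h s), fun _ _ φ a => (hg.1.realize φ fun i => (a i).1).symm,
    fun s b hb => Subtype.ext (hg.2 s b hb)⟩, fun _ _ => rfl⟩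

theorem apply_mem_acl_iff {A : M.SSet} {g : ∀ s, Equiv.Perm (M.Carrier s)} (hg : g ∈ fixAut A)
    (s : L.Sorts) (x : M.Carrier s) : g s x ∈ acl A s ↔ x ∈ acl A s :=
  ⟨fun h => by simpa [inv_apply_apply] using apply_mem_acl (inv_mem hg) h, apply_mem_acl hg⟩

theorem exists_absGal_restriction {A : M.SSet} {g : ∀ s, Equiv.Perm (M.Carrier s)}
    (hg : g ∈ fixAut A) : ∃ σ : absGal A, ∀ s (x : acl A s), (σ.1 s x : M.Carrier s) = g s x :=
  exists_restriction (by rwa [fixAut_dcl]) (apply_mem_acl_iff hg)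

theorem IsMonster.exists_absGal_extension {κ : Cardinal.{u}} (hM : M.IsMonster κ) {A : M.SSet}
    (hA : A.card < κ) (σ : absGal A) :
    ∃ g ∈ fixAut A, ∀ s (x : acl A s), g s x = σ.1 s x := by
  have := hM.exists_extension (card_acl_lt hM hA) (dcl_le_acl A) σ
  rwa [fixAut_dcl] at this

/-! Codes of finite sets of tuples. -/

/-- If `M` eliminates imaginaries, then every finite set `X` of tuples has a code: a tuple `c`
such that an automorphism fixes `c` if and only if it preserves `X`. -/
theorem HasEI.exists_code (hM : M.HasEI) {n : ℕ} {σ : Fin n → L.Sorts}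
    {X : Set (∀ i, M.Carrier (σ i))} (hX : X.Finite) :
    ∃ (m : ℕ) (τ : Fin m → L.Sorts) (c : ∀ j, M.Carrier (τ j)), ∀ g, M.IsAut g →
      ((∀ j, g (τ j) (c j) = c j) ↔ (fun v i => g (σ i) (v i)) '' X = X) := by
  obtain ⟨q, x, -, rfl⟩ := hX.fin_param
  let e : Fin q × Fin n ≃ Fin (q * n) := finProdFinEquiv
  let ρ : Fin (q * n) → L.Sorts := fun k => σ (e.symm k).2
  have hρ (i : Fin q) (l : Fin n) : ρ (e (i, l)) = σ l := by simp [ρ]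
  let row (v : ∀ k, M.Carrier (ρ k)) (i : Fin q) : ∀ l, M.Carrier (σ l) :=
    fun l => hρ i l ▸ v (e (i, l))
  have hrow (v : ∀ k, M.Carrier (ρ k)) (i : Fin q) (l : Fin n) : HEq (row v i l) (v (e (i, l))) :=
    eqRec_heq ..
  -- A `q`-tuple of `n`-tuples is flattened to length `q * n`, and two of them are equivalent if
  -- they enumerate the same set. The class of an enumeration of `X` is then an imaginary coding
  -- `X`.
  let θ : Setoid (∀ k, M.Carrier (ρ k)) := Setoid.comap (fun v => Set.range (row v)) ⊥
  have hθ (v w : ∀ k, M.Carrier (ρ k)) : θ v w ↔ Set.range (row v) = Set.range (row w) := Iff.rfl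
  obtain ⟨m, τ, f, ⟨d, k, φ, hφ⟩, hf⟩ := hM (q * n) ρ θ (by
    have key : Dfn (M := M) (Sum.elim ρ ρ) (fun v =>
        (∀ i, ∃ j, ∀ l, HEq (v (.inl (e (i, l)))) (v (.inr (e (j, l))))) ∧
        (∀ i, ∃ j, ∀ l, HEq (v (.inr (e (i, l)))) (v (.inl (e (j, l)))))) :=
      (Dfn.forall_finite fun i => .exists_finite fun j => .forall_finite fun l =>
        Dfn.heq (σ := Sum.elim ρ ρ) (.inl (e (i, l))) (.inr (e (j, l)))
          ((hρ j l).trans (hρ i l).symm)).and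
      (Dfn.forall_finite fun i => .exists_finite fun j => .forall_finite fun l =>
        Dfn.heq (σ := Sum.elim ρ ρ) (.inr (e (i, l))) (.inl (e (j, l)))
          ((hρ j l).trans (hρ i l).symm))
    refine key.congr fun v => ?_
    have hr (v w : ∀ k, M.Carrier (ρ k)) (i j : Fin q) :
        (∀ l, HEq (v (e (i, l))) (w (e (j, l)))) ↔ row w j = row v i := by
      rw [funext_iff]
      exact forall_congr' fun l => ⟨fun h => eq_of_heq
        (((hrow w j l).trans h.symm).trans (hrow v i l).symm), fun h =>
        ((hrow v i l).symm.trans (heq_of_eq h.symm)).trans (hrow w j l)⟩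
    change _ ↔ Set.range (row fun k => v (.inl k)) = Set.range (row fun k => v (.inr k))
    rw [Set.Subset.antisymm_iff, Set.range_subset_iff, Set.range_subset_iff]
    exact and_congr
      (forall_congr' fun i => exists_congr fun j => hr (fun k => v (.inl k)) (fun k => v (.inr k)) i j)
      (forall_congr' fun i => exists_congr fun j => hr (fun k => v (.inr k)) (fun k => v (.inl k)) i j))
  have hrow' (y : Fin q → ∀ l, M.Carrier (σ l)) :
      row (fun k => y (e.symm k).1 (e.symm k).2) = y := by
    funext i l
    refine eq_of_heq ((hrow (fun k => y (e.symm k).1 (e.symm k).2) i l).trans ?_)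
    change HEq (y (e.symm (e (i, l))).1 (e.symm (e (i, l))).2) (y i l)
    rw [Equiv.symm_apply_apply]
  -- The graph of `f` is definable without parameters, so `f` commutes with automorphisms.
  have hfg {g : ∀ s, Equiv.Perm (M.Carrier s)} (hg : M.IsAut g) (v : ∀ k, M.Carrier (ρ k)) :
      f (fun k => g (ρ k) (v k)) = fun j => g (τ j) (f v j) := by
    let u (v : ∀ k, M.Carrier (ρ k)) (w : ∀ j, M.Carrier (τ j)) :
        ∀ i, M.Carrier (Sum.elim ρ τ i) := fun i => match i with
      | .inl k => v k
      | .inr j => w j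
    have h := (hφ (u v (f v))).1 rfl
    rw [← hg.realize] at h
    have hu : (fun i => g _ (u v (f v) i)) =
        u (fun k => g (ρ k) (v k)) (fun j => g (τ j) (f v j)) := by
      funext i
      cases i <;> rfl
    have h' := (hφ (u (fun k => g (ρ k) (v k)) (fun j => g (τ j) (f v j)))).2 (by rwa [← hu])
    exact h'
  refine ⟨m, τ, f fun k => x (e.symm k).1 (e.symm k).2, fun g hg => ?_⟩
  rw [← funext_iff (f := fun j => g (τ j) (f _ j)), ← hfg hg, hf, hθ, hrow',
    hrow' (fun i l => g (σ l) (x i l)), ← Set.range_comp]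
  rfl
theorem SSet.card_mono {A B : M.SSet} (h : A ≤ B) : A.card ≤ B.card :=
  Cardinal.mk_le_of_injective (f := fun p : Σ s, A s => (⟨p.1, p.2, h p.1 p.2.2⟩ : Σ s, B s))
    (Function.Injective.of_comp (f := fun p : Σ s, B s => (⟨p.1, p.2⟩ : Σ s, M.Carrier s))
      (SSet.sigma_val_injective A))

/-! The Galois correspondence. -/

/-- Let `H` be a group of automorphisms over `E`. If an automorphism `h` over `E` fixes all
elements of `acl(E)` that are fixed by `H`, then `h` agrees with an element of `H` on any given
finite subset of `acl(E)`. -/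
theorem IsMonster.exists_mem_eqOn {κ : Cardinal.{u}} (hM : M.IsMonster κ) (hEI : M.HasEI)
    {E : M.SSet} (hE : E.card < κ) {H : Subgroup (∀ s, Equiv.Perm (M.Carrier s))}
    (hH : H ≤ fixAut E) {h : ∀ s, Equiv.Perm (M.Carrier s)} (hh : h ∈ fixAut E)
    (hfix : ∀ s, ∀ y ∈ acl E s, (∀ g ∈ H, g s y = y) → h s y = y)
    {S : Set (Σ s, acl E s)} (hS : S.Finite) :
    ∃ g ∈ H, ∀ p ∈ S, g p.1 p.2 = h p.1 p.2 := by
  obtain ⟨n, b, -, rfl⟩ := hS.fin_param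
  let X : Set (∀ i, M.Carrier (b i).1) := {v | ∃ g ∈ H, v = fun i => g _ (b i).2}
  have hX : X.Finite := by
    refine (Set.Finite.pi' fun i => finite_orbit_of_mem_acl (b i).2.2).subset ?_
    rintro _ ⟨g, hg, rfl⟩ i
    exact ⟨g, hH hg, rfl⟩
  have hXacl (v : X) (i : Fin n) : v.1 i ∈ acl E (b i).1 := by
    obtain ⟨_, g, hg, rfl⟩ := v
    exact apply_mem_acl (hH hg) (b i).2.2
  obtain ⟨m, τ, c, hc⟩ := hEI.exists_code hX
  -- An automorphism over `E` that fixes all entries of all members of `X` preserves `X`, so it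
  -- fixes `c`; these entries form a finite family from `acl E`.
  have hcacl (j : Fin m) : c j ∈ acl E (τ j) := by
    have := hX.to_subtype
    refine hM.mem_acl_of_tuple hE (fun p : X × Fin n => ⟨_, p.1.1 p.2, hXacl p.1 p.2⟩)
      fun g hg hgX => (hc g hg.1).2 ?_ j
    refine (Set.image_congr fun v hv => ?_).trans (Set.image_id _)
    funext i
    exact hgX (⟨v, hv⟩, i)
  have hcH (j : Fin m) (g) (hg : g ∈ H) : g (τ j) (c j) = c j := by
    refine (hc g (hH hg).1).2 (Set.Subset.antisymm ?_ ?_) j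
    · rintro _ ⟨_, ⟨g', hg', rfl⟩, rfl⟩
      exact ⟨g * g', mul_mem hg hg', rfl⟩
    · rintro _ ⟨g', hg', rfl⟩
      refine ⟨_, ⟨g⁻¹ * g', mul_mem (inv_mem hg) hg', rfl⟩, funext fun i => ?_⟩
      exact (g _).apply_symm_apply _
  have hhX := (hc h hh.1).1 fun j => hfix _ _ (hcacl j) (hcH j)
  obtain ⟨g, hg, hgb⟩ : (fun i => h _ (b i).2) ∈ X := by
    rw [← hhX]
    exact ⟨_, ⟨1, one_mem _, rfl⟩, rfl⟩
  refine ⟨g, hg, ?_⟩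
  rintro _ ⟨i, rfl⟩
  exact (congrFun hgb i).symm

/-- An open subgroup contains the stabilizer of a finite set. -/
theorem exists_finite_of_isOpen {B A : M.SSet} {N : Subgroup (aut B A)}
    (hN : IsOpen (N : Set (aut B A))) :
    ∃ S : Set (Σ s, B s), S.Finite ∧ ∀ σ : aut B A, (∀ p ∈ S, σ.1 p.1 p.2 = p.2) → σ ∈ N := by
  let (p : Σ s, B s) : TopologicalSpace (B p.1) := ⊥
  obtain ⟨U, hU, hUN⟩ := isOpen_induced_iff.1 hN
  have h1 : (fun p : Σ s, B s => p.2) ∈ U := by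
    have : (1 : aut B A) ∈ (N : Set (aut B A)) := one_mem N
    rw [← hUN] at this
    exact this
  obtain ⟨I, u, hu, hIU⟩ := isOpen_pi_iff.1 hU _ h1
  refine ⟨I, I.finite_toSet, fun σ hσ => ?_⟩
  rw [← SetLike.mem_coe, ← hUN]
  refine hIU fun p hp => ?_
  change σ.1 p.1 p.2 ∈ u p
  rw [hσ p hp]
  exact (hu p hp).2

/-- The automorphisms of `M` over `E` whose restriction to `acl(E)` is in `N`. -/
def liftSubgroup (E : M.SSet) (N : Subgroup (absGal E)) :
    Subgroup (∀ s, Equiv.Perm (M.Carrier s)) where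
  carrier := {g | g ∈ fixAut E ∧ ∃ σ ∈ N, ∀ s (x : acl E s), g s x = σ.1 s x}
  mul_mem' := by
    rintro g g' ⟨hg, σ, hσ, h⟩ ⟨hg', σ', hσ', h'⟩
    exact ⟨mul_mem hg hg', σ * σ', mul_mem hσ hσ', fun s x =>
      (congrArg (g s) (h' s x)).trans (h s _)⟩
  one_mem' := ⟨one_mem _, 1, one_mem _, fun _ _ => rfl⟩
  inv_mem' := by
    rintro g ⟨hg, σ, hσ, h⟩
    refine ⟨inv_mem hg, σ⁻¹, inv_mem hσ, fun s x => ?_⟩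
    rw [Pi.inv_apply, Equiv.Perm.inv_eq_iff_eq, h]
    exact congrArg Subtype.val ((σ.1 s).apply_symm_apply x).symm

/-- An element of `G(E)` that fixes `acl(E)^N` pointwise, for open `N`, is in `N`. -/
theorem IsMonster.mem_of_fixes_fixedSet {κ : Cardinal.{u}} (hM : M.IsMonster κ) (hEI : M.HasEI)
    {E : M.SSet} (hE : E.card < κ) {N : Subgroup (absGal E)}
    (hN : IsOpen (N : Set (absGal E))) {σ : absGal E}
    (hσ : ∀ s (x : acl E s), (x : M.Carrier s) ∈ fixedSet E N s → σ.1 s x = x) : σ ∈ N := by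
  obtain ⟨S, hS, hSN⟩ := exists_finite_of_isOpen hN
  obtain ⟨h, hh, hhσ⟩ := hM.exists_absGal_extension hE σ
  -- The points of `acl E` fixed by all lifts of `N` form `fixedSet E N`. So some `ν` in `N` agrees
  -- with `σ` on `S`, and `ν⁻¹ * σ` is in `N` because it fixes `S`.
  obtain ⟨g, ⟨-, ν, hν, hgν⟩, hgS⟩ := hM.exists_mem_eqOn hEI hE (H := liftSubgroup E N)
    (fun g hg => hg.1) hh (fun s y hy hyN => by
      refine (hhσ s ⟨y, hy⟩).trans (congrArg Subtype.val (hσ s ⟨y, hy⟩ ⟨hy, fun ν hν => ?_⟩))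
      obtain ⟨g, hg, hgν⟩ := hM.exists_absGal_extension hE ν
      exact (hgν s ⟨y, hy⟩).symm.trans (hyN g ⟨hg, ν, hν, hgν⟩)) hS
  have key : ν⁻¹ * σ ∈ N := hSN _ fun p hp => by
    change (ν.1 p.1).symm (σ.1 p.1 p.2) = p.2
    rw [Equiv.symm_apply_eq]
    exact Subtype.ext (((hhσ _ _).symm.trans (hgS p hp).symm).trans (hgν _ _))
  exact (Subgroup.mul_mem_cancel_left N (inv_mem hν)).1 key

theorem le_fixedSet (K : M.SSet) (N : Subgroup (absGal K)) : K ≤ fixedSet K N := fun s _ hx =>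
  ⟨dcl_le_acl K s (le_dcl K s hx), fun g _ => congrArg Subtype.val (g.2.2 s _ (le_dcl K s hx))⟩

theorem fixedSet_le_acl (K : M.SSet) (N : Subgroup (absGal K)) : fixedSet K N ≤ acl K :=
  fun _ _ hx => hx.1

/-- Elements of `N` lift to automorphisms of `M`, and these fix whatever is definable from a tuple
that they fix. -/
theorem IsMonster.dcl_fixedSet {κ : Cardinal.{u}} (hM : M.IsMonster κ) {K : M.SSet}
    (hK : K.card < κ) (N : Subgroup (absGal K)) : dcl (fixedSet K N) = fixedSet K N := by
  refine le_antisymm (fun s x hx => ?_) (le_dcl _)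
  obtain ⟨n, b, hb⟩ := exists_tuple_of_mem_dcl hx
  have hxK : x ∈ acl K s := hM.mem_acl_of_tuple hK
    (fun i => ⟨(b i).1, (b i).2, fixedSet_le_acl K N _ (b i).2.2⟩) fun g hg => hb g hg.1
  refine ⟨hxK, fun ν hν => ?_⟩
  obtain ⟨g, hg, hgν⟩ := hM.exists_absGal_extension hK ν
  rw [← hgν s ⟨x, hxK⟩]
  exact hb g hg.1 fun i =>
    (hgν (b i).1 ⟨(b i).2.1, (b i).2.2.1⟩).trans ((b i).2.2.2 ν hν)

theorem IsMonster.isGaloisExt_fixedSet {κ : Cardinal.{u}} (hM : M.IsMonster κ) {K : M.SSet}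
    (hK : K.card < κ) (N : Subgroup (absGal K)) [N.Normal] : IsGaloisExt K (fixedSet K N) where
  le := le_fixedSet K N
  dcl_eq := hM.dcl_fixedSet hK N
  le_acl := fixedSet_le_acl K N
  normal := by
    intro g hg hgK s x hx
    obtain ⟨σ, hσ⟩ := exists_absGal_restriction (A := K) ⟨hg, hgK⟩
    refine ⟨apply_mem_acl ⟨hg, hgK⟩ hx.1, fun ν hν => ?_⟩
    have h := hx.2 _ (Subgroup.Normal.conj_mem' ‹N.Normal› ν hν σ)
    have h' : (σ.1 s).symm (ν.1 s (σ.1 s ⟨x, hx.1⟩)) = ⟨x, hx.1⟩ := Subtype.ext h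
    rw [Equiv.symm_apply_eq] at h'
    have hσx : σ.1 s ⟨x, hx.1⟩ = ⟨g s x, apply_mem_acl ⟨hg, hgK⟩ hx.1⟩ :=
      Subtype.ext (hσ s ⟨x, hx.1⟩)
    rw [hσx] at h'
    exact congrArg Subtype.val h'

theorem IsGaloisExt.apply_mem_iff {K K' : M.SSet} (h : IsGaloisExt K K')
    {g : ∀ s, Equiv.Perm (M.Carrier s)} (hg : g ∈ fixAut K) (s : L.Sorts) (x : M.Carrier s) :
    g s x ∈ K' s ↔ x ∈ K' s :=
  ⟨fun hx => by
    simpa [inv_apply_apply] using h.normal g⁻¹ (inv_mem hg).1 (inv_mem hg).2 s _ hx,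
    h.normal g hg.1 hg.2 s x⟩

theorem IsMonster.exists_gal_extension {κ : Cardinal.{u}} (hM : M.IsMonster κ) {K : M.SSet}
    (hK : K.card < κ) {N : Subgroup (absGal K)} (γ : gal (fixedSet K N) K) :
    ∃ g ∈ fixAut K, ∀ s (x : dcl (fixedSet K N) s), g s x = γ.1 s x := by
  have hcard : (dcl (fixedSet K N)).card < κ := by
    rw [hM.dcl_fixedSet hK]
    exact (SSet.card_mono (fixedSet_le_acl K N)).trans_lt (card_acl_lt hM hK)
  have := hM.exists_extension hcard (dcl_mono (le_fixedSet K N)) γ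
  rwa [fixAut_dcl] at this

/-- `G(acl(K)^N/K)` is finite for open `N`. -/
theorem IsMonster.finite_gal_fixedSet {κ : Cardinal.{u}} (hM : M.IsMonster κ) {K : M.SSet}
    (hK : K.card < κ) {N : Subgroup (absGal K)} (hN : IsOpen (N : Set (absGal K))) :
    Finite (gal (fixedSet K N) K) := by
  obtain ⟨S, hS, hSN⟩ := exists_finite_of_isOpen hN
  choose g hg hgγ using fun γ : gal (fixedSet K N) K => hM.exists_gal_extension hK γ
  choose σ hσ using fun γ => exists_absGal_restriction (hg γ)
  have := hS.to_subtype
  have (p : S) := (finite_orbit_of_mem_acl p.1.2.2).to_subtype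
  -- An element `γ` is determined by the values of its chosen lift on `S`, which lie in finite
  -- orbits: if two lifts agree on `S`, their restrictions to `acl K` differ by an element of `N`,
  -- which is trivial on `fixedSet K N`.
  refine Finite.of_injective (β := ∀ p : S, {y | ∃ g ∈ fixAut K, g p.1.1 p.1.2 = y})
    (fun γ p => ⟨g γ _ _, g γ, hg γ, rfl⟩) fun γ γ' h => ?_
  have key : (σ γ)⁻¹ * σ γ' ∈ N := hSN _ fun p hp => by
    change ((σ γ).1 p.1).symm ((σ γ').1 p.1 p.2) = p.2
    rw [Equiv.symm_apply_eq]
    refine Subtype.ext ((hσ γ' _ _).trans (Eq.trans ?_ (hσ γ _ _).symm))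
    exact (congrArg Subtype.val (congrFun h ⟨p, hp⟩)).symm
  refine Subtype.ext (funext fun s => Equiv.ext fun x => Subtype.ext ?_)
  have hx : (x : M.Carrier s) ∈ fixedSet K N s :=
    (hM.dcl_fixedSet hK N).le s x.2
  have h' : ((σ γ).1 s).symm ((σ γ').1 s ⟨x, hx.1⟩) = ⟨x, hx.1⟩ := Subtype.ext (hx.2 _ key)
  rw [Equiv.symm_apply_eq] at h'
  rw [← hgγ, ← hgγ]
  exact ((hσ γ s ⟨x, hx.1⟩).symm.trans (congrArg Subtype.val h').symm).trans (hσ γ' s ⟨x, hx.1⟩)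

theorem memF_of_injective {K : M.SSet} {N : Subgroup (absGal K)} {k : ℕ} {J : Fin k → L.Sorts}
    (h : Function.Injective (galToPerm (fixedSet K N) K J)) : MemF K N J :=
  (MonoidHom.ofInjective h).toEquiv.cardinal_eq.symm

/-- A surjection from a finite group onto its image is injective as soon as the cardinalities agree;
this is where finiteness of the Galois group matters. -/
theorem MemF.injective {K : M.SSet} {N : Subgroup (absGal K)} {k : ℕ} {J : Fin k → L.Sorts}
    [Finite (gal (fixedSet K N) K)] (h : MemF K N J) :
    Function.Injective (galToPerm (fixedSet K N) K J) := by
  have hs := (galToPerm (fixedSet K N) K J).rangeRestrict_surjective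
  have := (hs.bijective_of_nat_card_le (congrArg Cardinal.toNat h).ge).1
  exact (MonoidHom.rangeRestrict_injective_iff).1 this

/-! The restriction map. -/

theorem continuous_res {E F : M.SSet} (h : E ≤ F) : Continuous (res h) := by
  let (p : Σ s, acl E s) : TopologicalSpace (acl E p.1) := ⊥
  have (p : Σ s, acl E s) : DiscreteTopology (acl E p.1) := ⟨rfl⟩
  let (p : Σ s, acl F s) : TopologicalSpace (acl F p.1) := ⊥
  have (p : Σ s, acl F s) : DiscreteTopology (acl F p.1) := ⟨rfl⟩
  refine continuous_induced_rng.2 (continuous_pi fun p => continuous_discrete_rng.2 fun y => ?_)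
  let q : Σ s, acl F s := ⟨p.1, p.2, acl_mono h _ p.2.2⟩
  have hq : Continuous fun g : absGal F => g.1 q.1 q.2 :=
    (continuous_apply (A := fun p : Σ s, acl F s => acl F p.1) q).comp
      (continuous_induced_dom (f := fun (g : absGal F) (p : Σ s, acl F s) => g.1 p.1 p.2))
  convert (isOpen_discrete ({⟨y, acl_mono h _ y.2⟩} : Set (acl F q.1))).preimage hq using 1
  ext g
  change (res h g).1 p.1 p.2 = y ↔ g.1 q.1 q.2 = ⟨y, acl_mono h _ y.2⟩
  rw [Subtype.ext_iff, Subtype.ext_iff]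
  rfl

theorem IsMonster.surjective_res {κ : Cardinal.{u}} (hM : M.IsMonster κ) (hEI : M.HasEI)
    {E F : M.SSet} (hE : E.card < κ) (hF : F.card < κ) (hreg : IsRegularExt E F) :
    Function.Surjective (res hreg.le) := by
  intro σ
  obtain ⟨h, hh, hhσ⟩ := hM.exists_absGal_extension hE σ
  let ρ : (Σ s, acl E s) ⊕ (Σ s, F s) → L.Sorts := Sum.elim Sigma.fst Sigma.fst
  let x : ∀ i, M.Carrier (ρ i) := fun i => match i with
    | .inl p => p.2.1
    | .inr p => p.2.1
  let y : ∀ i, M.Carrier (ρ i) := fun i => match i with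
    | .inl p => h p.1 p.2.1
    | .inr p => p.2.1
  have hI : Cardinal.mk ((Σ s, acl E s) ⊕ (Σ s, F s)) < κ := by
    rw [Cardinal.mk_sum, Cardinal.lift_id, Cardinal.lift_id]
    exact Cardinal.add_lt_of_lt hM.aleph0_lt.le (card_acl_lt hM hE) hF
  -- The map given by `σ` on `acl E` and the identity on `F` is elementary: each formula involves
  -- finitely many variables, and there `h` agrees on the part from `acl E` with an automorphism
  -- over `F`.
  obtain ⟨g, hg, hxy⟩ := hM.exists_aut hI (x := x) (y := y) <| by
    rintro R ⟨n, e, φ, hφ⟩ hR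
    obtain ⟨g, hg, hgS⟩ := hM.exists_mem_eqOn hEI hE (fixAut_anti hreg.le) hh
      -- Regularity enters here: an element of `acl E` fixed by all automorphisms over `F` lies in
      -- `dcl F ⊓ acl E`, which is `dcl E`.
      (fun s z hz hzF => apply_eq_of_mem_dcl hh <| by
        rw [← hreg.dcl_inf_acl]
        exact ⟨hM.mem_dcl hF hzF, hz⟩)
      ((Set.finite_range e).preimage Sum.inl_injective.injOn)
    rw [hφ] at hR ⊢
    rw [← hg.1.realize] at hR
    have hxy (k : Fin n) : y (e k) = g _ (x (e k)) := by
      have hk : e k ∈ Set.range e := ⟨k, rfl⟩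
      generalize e k = i at hk
      obtain p | p := i
      · exact (hgS p hk).symm
      · exact (hg.2 _ _ p.2.2).symm
    simpa only [hxy] using hR
  obtain ⟨τ, hτ⟩ := exists_absGal_restriction (A := F)
    ⟨hg, fun s z hz => hxy (.inr ⟨s, z, hz⟩)⟩
  refine ⟨τ, Subtype.ext (funext fun s => Equiv.ext fun z => Subtype.ext ?_)⟩
  exact ((hτ s ⟨z, acl_mono hreg.le s z.2⟩).trans (hxy (.inl ⟨s, z⟩))).trans (hhσ s z)

theorem fixedSet_le_fixedSet_comap {E F : M.SSet} (h : E ≤ F) (N : Subgroup (absGal E)) :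
    fixedSet E N ≤ fixedSet F (N.comap (res h)) :=
  fun s _ hx => ⟨acl_mono h s hx.1, fun g hg => hx.2 (res h g) hg⟩

theorem le_adjoin (A : M.SSet) {s : L.Sorts} (a : M.Carrier s) : A ≤ adjoin A a :=
  fun _ => Set.subset_union_left

theorem mem_adjoin (A : M.SSet) {s : L.Sorts} (a : M.Carrier s) : a ∈ adjoin A a s := Or.inr rfl

theorem adjoin_le {A B : M.SSet} (h : A ≤ B) {s : L.Sorts} {a : M.Carrier s} (ha : a ∈ B s) :
    adjoin A a ≤ B := by
  rintro t y (hy | hy)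
  · exact h t hy
  · obtain ⟨rfl, hy⟩ := Sigma.mk.inj hy
    obtain rfl := eq_of_heq hy
    exact ha

theorem IsMonster.card_adjoin_lt {κ : Cardinal.{u}} (hM : M.IsMonster κ) {A : M.SSet}
    (hA : A.card < κ) {s : L.Sorts} {a : M.Carrier s} (ha : a ∈ acl A s) :
    (adjoin A a).card < κ :=
  (SSet.card_mono (adjoin_le ((le_dcl A).trans (dcl_le_acl A)) ha)).trans_lt (card_acl_lt hM hA)

/-- An element of `G(F)` that is the restriction of an automorphism fixing `acl(E)^N` pointwise
is in the preimage of `N`. -/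
theorem IsMonster.mem_comap_res {κ : Cardinal.{u}} (hM : M.IsMonster κ) (hEI : M.HasEI)
    {E F : M.SSet} (hE : E.card < κ) (h : E ≤ F) {N : Subgroup (absGal E)}
    (hN : IsOpen (N : Set (absGal E))) {g : ∀ s, Equiv.Perm (M.Carrier s)}
    (hg : ∀ s, ∀ x ∈ fixedSet E N s, g s x = x) {σ : absGal F}
    (hσ : ∀ s (x : acl F s), (σ.1 s x : M.Carrier s) = g s x) : σ ∈ N.comap (res h) :=
  hM.mem_of_fixes_fixedSet hEI hE hN fun s x hx => Subtype.ext <|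
    (hσ s ⟨x, acl_mono h s x.2⟩).trans (hg s x hx)

/-- An automorphism over `F` and `a` fixes `dcl (adjoin E a)`, which is `fixedSet E N`, so its
restriction to `acl F` is in the preimage of `N`. Hence it fixes the fixed set of that preimage. -/
theorem IsMonster.isPrimitive_comap {κ : Cardinal.{u}} (hM : M.IsMonster κ) (hEI : M.HasEI)
    {E F : M.SSet} (hE : E.card < κ) (hF : F.card < κ) (h : E ≤ F) {N : Subgroup (absGal E)}
    [N.Normal] (hN : IsOpen (N : Set (absGal E))) {s : L.Sorts} {a : M.Carrier s}
    (ha : IsPrimitive E (fixedSet E N) a) :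
    IsPrimitive F (fixedSet F (N.comap (res h))) a := by
  have haN : a ∈ fixedSet E N s := by
    rw [ha.2]
    exact le_dcl _ s (mem_adjoin E a)
  have haF := fixedSet_le_fixedSet_comap h N s haN
  refine ⟨hM.isGaloisExt_fixedSet hF _, le_antisymm (fun t x hx => ?_) ?_⟩
  · refine hM.mem_dcl (hM.card_adjoin_lt hF haF.1) fun g hg => ?_
    obtain ⟨σ, hσ⟩ := exists_absGal_restriction (fixAut_anti (le_adjoin F a) hg)
    rw [← hσ t ⟨x, hx.1⟩]
    refine hx.2 σ (hM.mem_comap_res hEI hE h hN (fun t y hy => ?_) hσ)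
    rw [ha.2] at hy
    exact apply_eq_of_mem_dcl (fixAut_anti (adjoin_le (h.trans (le_adjoin F a))
      (mem_adjoin F a)) hg) hy
  · rw [← hM.dcl_fixedSet hF (N.comap (res h))]
    exact dcl_mono (adjoin_le (le_fixedSet F _) haF)

/-- An element trivial on `S_J` of the larger field is trivial on `S_J` of `fixedSet E N`. By
faithfulness there it fixes `fixedSet E N`, so its lift restricts into the preimage of `N`, and the
element is trivial. -/
theorem IsMonster.memF_comap {κ : Cardinal.{u}} (hM : M.IsMonster κ) (hEI : M.HasEI)
    {E F : M.SSet} (hE : E.card < κ) (hF : F.card < κ) (h : E ≤ F) {N : Subgroup (absGal E)}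
    [N.Normal] (hN : IsOpen (N : Set (absGal E))) {k : ℕ} {J : Fin k → L.Sorts}
    (hJ : MemF E N J) : MemF F (N.comap (res h)) J := by
  have := hM.finite_gal_fixedSet hE hN
  refine memF_of_injective ((injective_iff_map_eq_one _).2 fun γ hγ => ?_)
  obtain ⟨g, hg, hgγ⟩ := hM.exists_gal_extension hF γ
  have hgE := fixAut_anti h hg
  have hle := dcl_mono (fixedSet_le_fixedSet_comap h N)
  obtain ⟨γ₀, hγ₀⟩ : ∃ γ₀ : gal (fixedSet E N) E, ∀ s (x : dcl (fixedSet E N) s),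
      (γ₀.1 s x : M.Carrier s) = g s x := by
    refine exists_restriction (by rwa [fixAut_dcl]) ?_
    rw [hM.dcl_fixedSet hE]
    exact (hM.isGaloisExt_fixedSet hE N).apply_mem_iff hgE
  have h₁ : γ₀ = 1 := by
    refine hJ.injective (Eq.trans (Equiv.ext fun t => funext fun i => Subtype.ext ?_)
      (map_one _).symm)
    have := congrArg Subtype.val (congrFun (Equiv.congr_fun hγ
      fun i => ⟨t i, hle _ (t i).2⟩) i)
    exact (hγ₀ _ _).trans ((hgγ (J i) ⟨t i, hle _ (t i).2⟩).trans this)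
  have hgN : ∀ s, ∀ x ∈ fixedSet E N s, g s x = x := fun s x hx => by
    have := hγ₀ s ⟨x, le_dcl _ s hx⟩
    rw [h₁] at this
    exact this.symm
  obtain ⟨σ, hσ⟩ := exists_absGal_restriction hg
  have hσN := hM.mem_comap_res hEI hE h hN hgN hσ
  refine Subtype.ext (funext fun s => Equiv.ext fun x => Subtype.ext ?_)
  have hx : (x : M.Carrier s) ∈ fixedSet F (N.comap (res h)) s :=
    (hM.dcl_fixedSet hF _).le s x.2
  exact (hgγ s x).symm.trans ((hσ s ⟨x, hx.1⟩).symm.trans (hx.2 σ hσN))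

end Struct
end MSLanguage

theorem mainTheorem10 {L : MSLanguage.{u}} (T : L.Theory) (hstable : T.IsStable)
    (hEI : T.EliminatesImaginaries) (C : L.Struct) (hC : C.theory = T)
    (κ : Cardinal.{u}) (hmonster : C.IsMonster κ)
    (E F : C.SSet) (hE : E.card < κ) (hF : F.card < κ)
    (hreg : MSLanguage.Struct.IsRegularExt E F) :
    (∀ N : Subgroup (MSLanguage.Struct.absGal E), N.Normal →
      IsOpen (N : Set (MSLanguage.Struct.absGal E)) →
      ∀ (s : L.Sorts) (a : C.Carrier s),
        MSLanguage.Struct.IsPrimitive E (MSLanguage.Struct.fixedSet E N) a →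
        MSLanguage.Struct.IsPrimitive F
          (MSLanguage.Struct.fixedSet F (N.comap (MSLanguage.Struct.res hreg.le))) a) ∧
    MSLanguage.Struct.IsSorted (MSLanguage.Struct.res hreg.le) := by
  have hEI' : C.HasEI := hEI C (by subst hC; exact fun φ hφ => hφ)
  exact ⟨fun N _ hN _ _ ha => hmonster.isPrimitive_comap hEI' hE hF hreg.le hN ha,
    MSLanguage.Struct.continuous_res hreg.le, hmonster.surjective_res hEI' hE hF hreg,
    fun N _ hN _ _ hJ => hmonster.memF_comap hEI' hE hF hreg.le hN hJ⟩
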